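/- Finite algebras are given as lists of tables of their basic operations. The list is finite and non-empty, and no basic operation is nullary. The size of a finite algebra $\mathbf A$ with universe $A$ is $\|\mathbf A\|=\sum_{i\ge 1}k_i|A|^i$, where $k_i$ is the number of its $i$-ary basic operations. The algebra is idempotent if $f(x,\dots,x)=x$ for every basic operation $f$ and every $x\in A$. A Maltsev term operation of $\mathbf A$ is a ternary operation $p$ on $A$ that is induced by a term in the language of $\mathbf A$ and satisfies $p(x,x,y)=p(y,x,x)=y$ for all $x,y\in A$. There are a single algorithm (a program of a random access machine with addition and truncated subtraction, but no multiplication, at unit cost) and a polynomial $q$ such that, for every finite idempotent algebra $\mathbf A$, the algorithm halts on input $\mathbf A$ after at most $q(\|\mathbf A\|)$ steps, and its output is the full operation table (all $|A|^3$ values) of some Maltsev term operation of $\mathbf A$ if one exists, and the answer that there is none otherwise. -/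

import Mathlib

/-! ## Finite algebras given by a list of operation tables -/

/-- A finite algebra with universe `{0, …, card - 1}` and finitely many basic operations
`op 0, …, op (numOps - 1)`, the `i`-th one of arity `arity i`. -/
structure FinAlgebra where
  card : ℕ
  numOps : ℕ
  arity : Fin numOps → ℕ
  op : (i : Fin numOps) → (Fin (arity i) → Fin card) → Fin card

namespace FinAlgebra

variable (A : FinAlgebra)

/-- The universe of the algebra. -/
abbrev Carrier : Type := Fin A.card

/-- The algebra is idempotent: `f (x, x, …, x) = x` for every basic operation `f`. -/
def IsIdempotent : Prop :=
  ∀ (i : Fin A.numOps) (x : A.Carrier), A.op i (fun _ => x) = x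

/-- The size `‖A‖ = ∑ᵢ kᵢ |A| ^ i`, with `kᵢ` the number of `i`-ary basic operations; that is, the
sum of `|A| ^ (arity of f)` over all basic operations `f`. -/
def size : ℕ := ∑ i : Fin A.numOps, A.card ^ A.arity i

/-- The algebraic language of `A`: one function symbol for each basic operation. -/
abbrev lang : FirstOrder.Language.{0, 0} where
  Functions := fun m => {i : Fin A.numOps // A.arity i = m}
  Relations := fun _ => Empty

/-- Each function symbol is interpreted by its basic operation. -/
instance instStructure : A.lang.Structure A.Carrier where
  funMap := fun {_} f v => A.op f.1 (fun j => v (Fin.cast f.2 j))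
  RelMap := fun {_} r _ => Empty.elim r

/-- A ternary operation is a term operation of `A` if some term in the variables
`x₀, x₁, x₂` induces it. -/
def IsTermOperation (m : (Fin 3 → A.Carrier) → A.Carrier) : Prop :=
  ∃ t : A.lang.Term (Fin 3), ∀ v : Fin 3 → A.Carrier, t.realize v = m v

/-- The identities `p(x, x, y) ≈ p(y, x, x) ≈ y`. -/
def IsMaltsev (m : (Fin 3 → A.Carrier) → A.Carrier) : Prop :=
  ∀ x y : A.Carrier, m ![x, x, y] = y ∧ m ![y, x, x] = y

/-- `m` is a Maltsev term operation of `A`. -/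
def IsMaltsevTermOperation (m : (Fin 3 → A.Carrier) → A.Carrier) : Prop :=
  A.IsTermOperation m ∧ A.IsMaltsev m

end FinAlgebra

/-- The table of an `r`-ary operation on `{0, …, n - 1}`: the list of its `n ^ r` values, where the
value at `(x₀, …, x_{r-1})` stands at position `x₀ + x₁ n + ⋯ + x_{r-1} n ^ (r - 1)`. -/
def opTable {n r : ℕ} (f : (Fin r → Fin n) → Fin n) : List ℕ :=
  List.ofFn (fun c : Fin (n ^ r) => (f (finFunctionFinEquiv.symm c) : ℕ))

/-! ## A random access machine with uniform cost

A program uses finitely many registers and finitely many unbounded arrays of natural numbers.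
The arithmetic instructions are addition and truncated subtraction only: there is no
multiplication, so at unit cost per instruction the numbers stay polynomially long in the running
time and the length of the input, and polynomial time is the usual notion. -/

namespace RAM

/-- The contents of the registers and of the arrays. -/
structure State where
  reg : ℕ → ℕ
  arr : ℕ → ℕ → ℕ

/-- Expressions: a literal, a register, the array entry `a[e]`, a sum, a truncated difference. -/
inductive Expr : Type
  | const (c : ℕ) : Expr
  | reg (x : ℕ) : Expr
  | read (a : ℕ) (e : Expr) : Expr
  | add (e₁ e₂ : Expr) : Expr
  | sub (e₁ e₂ : Expr) : Expr

namespace Expr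

/-- The value of an expression. -/
def eval (s : State) : Expr → ℕ
  | const c => c
  | reg x => s.reg x
  | read a e => s.arr a (e.eval s)
  | add e₁ e₂ => e₁.eval s + e₂.eval s
  | sub e₁ e₂ => e₁.eval s - e₂.eval s

/-- The cost of evaluating an expression: one unit per node. -/
def cost : Expr → ℕ
  | const _ => 1
  | reg _ => 1
  | read _ e => e.cost + 1
  | add e₁ e₂ => e₁.cost + e₂.cost + 1
  | sub e₁ e₂ => e₁.cost + e₂.cost + 1

end Expr

/-- Assign `v` to register `x`. -/
def State.setReg (s : State) (x v : ℕ) : State where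
  reg := Function.update s.reg x v
  arr := s.arr

/-- Write `v` into entry `i` of array `a`. -/
def State.setArr (s : State) (a i v : ℕ) : State where
  reg := s.reg
  arr := Function.update s.arr a (Function.update (s.arr a) i v)

/-- Programs. Conditions are expressions, and count as true when their value is not zero. -/
inductive Prog : Type
  | skip : Prog
  | assign (x : ℕ) (e : Expr) : Prog
  | write (a : ℕ) (i e : Expr) : Prog
  | seq (p q : Prog) : Prog
  | ite (e : Expr) (p q : Prog) : Prog
  | loop (e : Expr) (p : Prog) : Prog

/-- `Exec p s t s'`: started in state `s`, the program `p` halts in state `s'` after exactly `t`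
steps. Each executed instruction and each test costs one step on top of the cost of the expressions
that it evaluates. A computation that does not halt has no such `t` and `s'`. -/
inductive Exec : Prog → State → ℕ → State → Prop
  | skip (s : State) : Exec Prog.skip s 1 s
  | assign (x : ℕ) (e : Expr) (s : State) :
      Exec (Prog.assign x e) s (e.cost + 1) (s.setReg x (e.eval s))
  | write (a : ℕ) (i e : Expr) (s : State) :
      Exec (Prog.write a i e) s (i.cost + e.cost + 1) (s.setArr a (i.eval s) (e.eval s))
  | seq {p q : Prog} {s s' s'' : State} {t t' : ℕ} :
      Exec p s t s' → Exec q s' t' s'' → Exec (Prog.seq p q) s (t + t') s''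
  | ite_true {e : Expr} {p q : Prog} {s s' : State} {t : ℕ} :
      e.eval s ≠ 0 → Exec p s t s' → Exec (Prog.ite e p q) s (e.cost + 1 + t) s'
  | ite_false {e : Expr} {p q : Prog} {s s' : State} {t : ℕ} :
      e.eval s = 0 → Exec q s t s' → Exec (Prog.ite e p q) s (e.cost + 1 + t) s'
  | loop_stop {e : Expr} {p : Prog} {s : State} :
      e.eval s = 0 → Exec (Prog.loop e p) s (e.cost + 1) s
  | loop_step {e : Expr} {p : Prog} {s s' s'' : State} {t t' : ℕ} :
      e.eval s ≠ 0 → Exec p s t s' → Exec (Prog.loop e p) s' t' s'' →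
      Exec (Prog.loop e p) s (e.cost + 1 + t + t') s''

/-- The initial state on input `A`: register `0` holds `|A|`, register `1` holds the number of basic
operations, array `0` holds their arities, array `1` holds their tables, one after the other, and
everything else is `0`. -/
def inputState (A : FinAlgebra) : State where
  reg := fun x => if x = 0 then A.card else if x = 1 then A.numOps else 0
  arr := fun a i =>
    if a = 0 then (List.ofFn A.arity).getD i 0
    else if a = 1 then
      ((List.finRange A.numOps).flatMap (fun j => opTable (A.op j))).getD i 0
    else 0

/-- The output is the table `T`: register `0` holds `1` and array `2` starts with `T`. -/
def OutputsTable (s : State) (T : List ℕ) : Prop :=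
  s.reg 0 = 1 ∧ (List.range T.length).map (s.arr 2) = T

/-- The output is the answer that there is nothing to produce: register `0` holds `0`. -/
def OutputsNone (s : State) : Prop := s.reg 0 = 0

end RAM

/-! Write n for |A|. A Maltsev term is assembled from local ones, each good for a single instance of
each identity. A term operation r with r(a,u,u) = a and r(w,w,d) = d exists iff (a,d) lies in the
subalgebra of A² generated by (a,w), (u,w), (u,d). That subalgebra has at most n² elements, so
closing under the basic operations finds it, keeping for every pair the n³-entry table of one
witnessing term (`searchProg_spec`, with completeness from `TermTable.key_mem`). A Maltsev operation
would itself be such an r, so a failed search proves that there is none.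

Idempotence allows witnesses to be composed without losing what was gained. Fix a and u, and let
k(a,u,u) = a. To repair k at (c,d), put w = k(c,c,d), take r as above, and pass to r(k(x,y,z),
k(y,y,z), z). At (a,u,u) this is r(a,u,u) = a, since k(u,u,u) = u; at (c,c,d) it is r(w,w,d) = d;
and where k(c',c',d') = d' held, it gives r(d',d',d') = d'. Starting from the first projection, n²
repairs yield k(a,u,u) = a together with k(x,x,y) = y everywhere (`innerProg_spec`).

One level up, let g(x,x,y) = y hold everywhere, put u = g(a,b,b), and take the k just built for a
and u. Then k(x, g(x,y,y), g(x,y,z)) keeps the identity, takes the value a at (a,b,b), and preserves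
every instance g(a',b',b') = a' already gained. Starting from the third projection, n² such steps
give a Maltsev term (`outerProg_spec`).

For the cost, a k-tuple of pairs is a pair of positions in a table of length n^k, so two nested
loops over that table visit all of them. Every loop thus makes at most n⁴ + ‖A‖ + 1 iterations, and
the nesting is fixed by the program text, so `Prog.bound` is a polynomial bound. Products, quotients
and remainders are looked up in tables built by counting. -/

namespace RAM

/-! ## Time-bounded weakest preconditions -/

@[simp] theorem State.setReg_reg (s : State) (x v y : ℕ) :
    (s.setReg x v).reg y = if y = x then v else s.reg y := by
  simp [State.setReg, Function.update_apply]

@[simp] theorem State.setReg_arr (s : State) (x v : ℕ) : (s.setReg x v).arr = s.arr := rfl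

@[simp] theorem State.setArr_reg (s : State) (a i v : ℕ) : (s.setArr a i v).reg = s.reg := rfl

@[simp] theorem State.setArr_arr (s : State) (a i v b : ℕ) :
    (s.setArr a i v).arr b = if b = a then Function.update (s.arr a) i v else s.arr b := by
  by_cases h : b = a
  · subst h; simp [State.setArr]
  · simp [State.setArr, h]

namespace Prog

/-- A bound for the running time of a program, as a polynomial in the maximal number of iterations
of a single loop. -/
noncomputable def bound : Prog → Polynomial ℕ
  | skip => 1
  | assign _ e => Polynomial.C (e.cost + 1)
  | write _ i e => Polynomial.C (i.cost + e.cost + 1)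
  | seq p q => p.bound + q.bound
  | ite e p q => Polynomial.C (e.cost + 1) + p.bound + q.bound
  | loop e p => Polynomial.X * (Polynomial.C (e.cost + 1) + p.bound) + Polynomial.C (e.cost + 1)

/-- Whether the program contains an assignment to register `x`. -/
def writesReg : Prog → ℕ → Bool
  | skip, _ => false
  | assign y _, x => x == y
  | write _ _ _, _ => false
  | seq p q, x => p.writesReg x || q.writesReg x
  | ite _ p q, x => p.writesReg x || q.writesReg x
  | loop _ p, x => p.writesReg x

/-- Whether the program contains an assignment to an entry of array `a`. -/
def writesArr : Prog → ℕ → Bool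
  | skip, _ => false
  | assign _ _, _ => false
  | write b _ _, a => a == b
  | seq p q, a => p.writesArr a || q.writesArr a
  | ite _ p q, a => p.writesArr a || q.writesArr a
  | loop _ p, a => p.writesArr a

/-- `s'` agrees with `s` wherever `p` does not write. -/
structure Frame (p : Prog) (s s' : State) : Prop where
  reg : ∀ x, p.writesReg x = false → s'.reg x = s.reg x
  arr : ∀ a, p.writesArr a = false → s'.arr a = s.arr a

theorem Frame.refl (p : Prog) (s : State) : Frame p s s := ⟨fun _ _ => rfl, fun _ _ => rfl⟩

theorem Frame.trans {p : Prog} {s s' s'' : State} (h : Frame p s s') (h' : Frame p s' s'') :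
    Frame p s s'' :=
  ⟨fun x hx => (h'.reg x hx).trans (h.reg x hx), fun a ha => (h'.arr a ha).trans (h.arr a ha)⟩

theorem Frame.mono {p q : Prog} {s s' : State} (h : Frame p s s')
    (hr : ∀ x, q.writesReg x = false → p.writesReg x = false)
    (ha : ∀ a, q.writesArr a = false → p.writesArr a = false) : Frame q s s' :=
  ⟨fun x hx => h.reg x (hr x hx), fun a hx => h.arr a (ha a hx)⟩

end Prog

open Prog

/-- Specifications may stay silent about what a program never writes: `wp.mono` hands out this
frame, and `rfl` decides which registers and arrays it covers. -/
theorem Exec.frame {p : Prog} {s s' : State} {t : ℕ} (h : Exec p s t s') : Frame p s s' := by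
  induction h with
  | skip s => exact Frame.refl _ _
  | assign x e s =>
    exact ⟨fun y hy => by simp_all [writesReg], fun _ _ => rfl⟩
  | write a i e s =>
    exact ⟨fun _ _ => rfl, fun b hb => by simp_all [writesArr]⟩
  | seq _ _ ih₁ ih₂ =>
    refine (ih₁.mono ?_ ?_).trans (ih₂.mono ?_ ?_) <;> simp +contextual [writesReg, writesArr]
  | ite_true _ _ ih => refine ih.mono ?_ ?_ <;> simp +contextual [writesReg, writesArr]
  | ite_false _ _ ih => refine ih.mono ?_ ?_ <;> simp +contextual [writesReg, writesArr]
  | loop_stop _ => exact Frame.refl _ _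
  | loop_step _ _ _ ih₁ ih₂ =>
    refine (ih₁.mono ?_ ?_).trans ih₂ <;> simp [writesReg, writesArr]

/-- Started in `s`, the program `p` halts within `p.bound.eval W` steps in a state satisfying `Q`. -/
def wp (W : ℕ) (p : Prog) (Q : State → Prop) (s : State) : Prop :=
  ∃ t s', Exec p s t s' ∧ t ≤ p.bound.eval W ∧ Q s'

/-! ### Proof rules for total correctness within the time bound. -/

variable {W : ℕ} {Q R : State → Prop} {s : State} {p q : Prog} {e : Expr}

theorem wp.mono (h : wp W p Q s) (hQ : ∀ s', Frame p s s' → Q s' → R s') : wp W p R s := by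
  obtain ⟨t, s', h₁, h₂, h₃⟩ := h
  exact ⟨t, s', h₁, h₂, hQ s' h₁.frame h₃⟩

theorem wp_skip (h : Q s) : wp W .skip Q s := ⟨1, s, .skip s, by simp [bound], h⟩

theorem wp_assign {x : ℕ} (h : Q (s.setReg x (e.eval s))) : wp W (.assign x e) Q s :=
  ⟨_, _, .assign x e s, by simp [bound], h⟩

theorem wp_write {a : ℕ} {i : Expr} (h : Q (s.setArr a (i.eval s) (e.eval s))) :
    wp W (.write a i e) Q s :=
  ⟨_, _, .write a i e s, by simp [bound], h⟩

theorem wp_seq (h : wp W p (wp W q Q) s) : wp W (.seq p q) Q s := by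
  obtain ⟨t, s', h₁, h₂, t', s'', h₃, h₄, h₅⟩ := h
  exact ⟨_, s'', .seq h₁ h₃, by simp only [bound, Polynomial.eval_add]; omega, h₅⟩

theorem wp_ite (h₁ : e.eval s ≠ 0 → wp W p Q s) (h₂ : e.eval s = 0 → wp W q Q s) :
    wp W (.ite e p q) Q s := by
  by_cases h : e.eval s = 0
  · obtain ⟨t, s', h₁, h₂, h₃⟩ := h₂ h
    exact ⟨_, s', .ite_false h h₁, by
      simp only [bound, Polynomial.eval_add, Polynomial.eval_C]; omega, h₃⟩
  · obtain ⟨t, s', h₁, h₂, h₃⟩ := h₁ h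
    exact ⟨_, s', .ite_true h h₁, by
      simp only [bound, Polynomial.eval_add, Polynomial.eval_C]; omega, h₃⟩

/-- The index of the invariant counts completed iterations, so it gives termination and the cost at
once: M passes and one last test. -/
theorem wp_loop {M : ℕ} (I : ℕ → State → Prop) (hM : M ≤ W) (h0 : I 0 s)
    (hstep : ∀ k s, k < M → I k s → e.eval s ≠ 0 ∧ wp W p (I (k + 1)) s)
    (hend : ∀ s, I M s → e.eval s = 0) : wp W (.loop e p) (I M) s := by
  have key : ∀ m k s, k + m = M → I k s → ∃ t s', Exec (.loop e p) s t s' ∧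
      t ≤ m * (e.cost + 1 + p.bound.eval W) + (e.cost + 1) ∧ I M s' := by
    intro m
    induction m with
    | zero =>
      intro k s hk h
      obtain rfl : k = M := by omega
      exact ⟨_, s, Exec.loop_stop (hend s h), by simp, h⟩
    | succ m ih =>
      intro k s hk h
      obtain ⟨h₁, t, s', h₂, h₃, h₄⟩ := hstep k s (by omega) h
      obtain ⟨t', s'', h₅, h₆, h₇⟩ := ih (k + 1) s' (by omega) h₄
      refine ⟨_, s'', .loop_step h₁ h₂ h₅, ?_, h₇⟩
      rw [Nat.succ_mul]
      omega
  obtain ⟨t, s', h₁, h₂, h₃⟩ := key M 0 s (by omega) h0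
  refine ⟨t, s', h₁, h₂.trans ?_, h₃⟩
  simp only [bound, Polynomial.eval_add, Polynomial.eval_mul, Polynomial.eval_X,
    Polynomial.eval_C]
  gcongr

namespace Prog

/-- `for i := 0, …, m - 1 do p`, where `m` is the content of register `m`. -/
def for_ (i m : ℕ) (p : Prog) : Prog :=
  seq (assign i (.const 0))
    (loop (.sub (.reg m) (.reg i)) (seq p (assign i (.add (.reg i) (.const 1)))))

/-- `for i := 0, …, m - 1 do a[b + i] := e`, where `m` and `b` are the contents of registers. -/
def fill (i m a b : ℕ) (e : Expr) : Prog :=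
  for_ i m (write a (.add (.reg b) (.reg i)) e)

end Prog

/-- The body has to establish the next invariant for the state in which the counter is already
raised. The frame back to the state before the loop makes it unnecessary to carry constants in `I`.
-/
theorem wp_for {i m M : ℕ} (I : ℕ → State → Prop) (hM : M ≤ W) (hm : s.reg m = M)
    (hw : (for_ i m p).writesReg m = false) (hi : p.writesReg i = false)
    (h0 : I 0 (s.setReg i 0))
    (hstep : ∀ k s₁, k < M → Frame (for_ i m p) s s₁ → s₁.reg i = k → I k s₁ →
      wp W p (fun s₂ => I (k + 1) (s₂.setReg i (k + 1))) s₁)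
    (hpost : ∀ s₁, Frame (for_ i m p) s s₁ → I M s₁ → Q s₁) : wp W (for_ i m p) Q s := by
  have frame0 : Frame (for_ i m p) s (s.setReg i 0) := by
    refine ⟨fun x hx => ?_, fun _ _ => rfl⟩
    simp only [for_, writesReg, Bool.or_eq_false_iff, beq_eq_false_iff_ne] at hx
    simp [hx.1]
  have frameM : ∀ {s₁ : State}, Frame (for_ i m p) s s₁ → s₁.reg m = M := fun hf => by
    rw [hf.reg m hw, hm]
  apply wp_seq
  apply wp_assign
  refine (wp_loop (fun k s₁ => Frame (for_ i m p) s s₁ ∧ s₁.reg i = k ∧ I k s₁) hM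
    ⟨frame0, by simp, h0⟩ ?_ ?_).mono ?_
  · rintro k s₁ hk ⟨hf, hik, hI⟩
    refine ⟨by simp only [Expr.eval, frameM hf, hik]; omega, ?_⟩
    apply wp_seq
    refine (hstep k s₁ hk hf hik hI).mono fun s₂ hf₂ hI₂ => ?_
    apply wp_assign
    have hi₂ : s₂.reg i = k := by rw [hf₂.reg i hi, hik]
    simp only [Expr.eval, hi₂]
    refine ⟨hf.trans ?_, by simp, hI₂⟩
    refine ⟨fun x hx => ?_, fun a ha => ?_⟩
    · simp only [for_, writesReg, Bool.or_eq_false_iff, beq_eq_false_iff_ne] at hx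
      simp [hx.1, hf₂.reg x hx.2.1]
    · simp only [for_, writesArr, Bool.or_eq_false_iff] at ha
      simp [hf₂.arr a ha.2.1]
  · rintro s₁ ⟨hf, hik, -⟩
    simp [Expr.eval, frameM hf, hik]
  · rintro s₁ - ⟨hf, -, hI⟩
    exact hpost s₁ hf hI

/-- In `he` nothing is known about array `a`, which is partly overwritten at that moment. This is
why composites that read a table are first written to scratch space. -/
theorem wp_fill {i m a b M B : ℕ} (f : ℕ → ℕ) (hM : M ≤ W) (hm : s.reg m = M)
    (hb : s.reg b = B) (him : m ≠ i) (hib : b ≠ i)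
    (he : ∀ j s₁, j < M → s₁.reg i = j → (∀ x ≠ i, s₁.reg x = s.reg x) →
      (∀ c ≠ a, s₁.arr c = s.arr c) → e.eval s₁ = f j)
    (hQ : ∀ s₁, (∀ x ≠ i, s₁.reg x = s.reg x) → (∀ c ≠ a, s₁.arr c = s.arr c) →
      (∀ j < M, s₁.arr a (B + j) = f j) →
      (∀ l, (∀ j < M, l ≠ B + j) → s₁.arr a l = s.arr a l) → Q s₁) :
    wp W (fill i m a b e) Q s := by
  have fr : ∀ {s₁}, Frame (fill i m a b e) s s₁ →
      (∀ x ≠ i, s₁.reg x = s.reg x) ∧ ∀ c ≠ a, s₁.arr c = s.arr c := fun hf =>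
    ⟨fun x hx => hf.reg x (by simp [fill, for_, writesReg, hx]),
      fun c hc => hf.arr c (by simp [fill, for_, writesArr, hc])⟩
  refine wp_for (fun k s₁ => (∀ j < k, s₁.arr a (B + j) = f j) ∧
    ∀ l, (∀ j < k, l ≠ B + j) → s₁.arr a l = s.arr a l) hM hm ?_ rfl ?_ ?_ ?_
  · simp [for_, writesReg, him]
  · simp
  · rintro k s₁ hk hf hik ⟨h₁, h₂⟩
    obtain ⟨hr, ha⟩ := fr hf
    apply wp_write
    simp only [State.setReg_arr, State.setArr_arr, if_true, Expr.eval, hr b hib, hb, hik,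
      he k s₁ hk hik hr ha]
    constructor
    · intro j hj
      rcases Nat.lt_succ_iff_lt_or_eq.1 hj with hj' | rfl
      · rw [Function.update_of_ne (by omega), h₁ j hj']
      · simp
    · intro l hl
      rw [Function.update_of_ne (hl k (by omega)), h₂ l fun j hj => hl j (by omega)]
  · rintro s₁ hf ⟨h₁, h₂⟩
    obtain ⟨hr, ha⟩ := fr hf
    exact hQ s₁ hr ha h₁ h₂

end RAM

/-! ## Tables of term operations -/

theorem finFunctionFinEquiv_symm_val {n r : ℕ} (c : Fin (n ^ r)) (j : Fin r) :
    (finFunctionFinEquiv.symm c j : ℕ) = c / n ^ (j : ℕ) % n := rfl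

theorem opTable_length {n r : ℕ} (f : (Fin r → Fin n) → Fin n) : (opTable f).length = n ^ r := by
  simp [opTable]

theorem opTable_getD {n r : ℕ} (f : (Fin r → Fin n) → Fin n) (v : Fin r → Fin n) :
    (opTable f).getD (finFunctionFinEquiv v : ℕ) 0 = f v := by
  rw [List.getD_eq_getElem _ _ (by rw [opTable_length]; exact Fin.isLt _)]
  simp only [opTable, List.getElem_ofFn, Fin.eta, Equiv.symm_apply_apply]

/-- A number below `n ^ r` is determined by its `r` digits in base `n`. -/
theorem eq_of_digits_eq {n r u v : ℕ} (hu : u < n ^ r) (hv : v < n ^ r)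
    (h : ∀ j < r, u / n ^ j % n = v / n ^ j % n) : u = v := by
  have : (⟨u, hu⟩ : Fin (n ^ r)) = ⟨v, hv⟩ := by
    apply finFunctionFinEquiv.symm.injective
    funext j
    exact Fin.ext (h j j.2)
  simpa using this

namespace FinAlgebra

open FirstOrder

variable (A : FinAlgebra)

/-- The entry at position `u` of the table of the `i`-th basic operation. -/
def opEntry (i : Fin A.numOps) (u : ℕ) : ℕ := (opTable (A.op i)).getD u 0

/-- The position where the table of the `i`-th basic operation starts in the input. -/
def offset (i : ℕ) : ℕ := (((List.finRange A.numOps).take i).map fun j => A.card ^ A.arity j).sum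

/-- The entries of `g` form the table of a ternary term operation. -/
def TermTable (g : ℕ → ℕ) : Prop :=
  ∃ t : A.lang.Term (Fin 3), ∀ v : Fin 3 → A.Carrier,
    g (v 0 + v 1 * A.card + v 2 * A.card * A.card) = t.realize v

variable {A}

theorem opEntry_eq {i : Fin A.numOps} {u : ℕ} (hu : u < A.card ^ A.arity i)
    (x : Fin (A.arity i) → A.Carrier)
    (h : ∀ j : Fin (A.arity i), u / A.card ^ (j : ℕ) % A.card = x j) :
    A.opEntry i u = A.op i x := by
  have : finFunctionFinEquiv.symm (⟨u, hu⟩ : Fin (A.card ^ A.arity i)) = x := by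
    funext j
    exact Fin.ext (h j)
  simp [opEntry, opTable, List.getD_eq_getElem?_getD, hu, this]

theorem opEntry_lt {i : Fin A.numOps} {u : ℕ} (hu : u < A.card ^ A.arity i) :
    A.opEntry i u < A.card := by
  rw [opEntry_eq hu (finFunctionFinEquiv.symm ⟨u, hu⟩) fun _ => rfl]
  exact Fin.isLt _

theorem offset_zero : A.offset 0 = 0 := by simp [offset]

theorem offset_succ (i : Fin A.numOps) :
    A.offset (i + 1) = A.offset i + A.card ^ A.arity i := by
  simp only [offset, List.map_take]
  rw [List.sum_take_succ _ _ (by simp)]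
  simp

theorem offset_numOps : A.offset A.numOps = A.size := by
  rw [offset, List.take_of_length_le (by simp), size, ← List.ofFn_eq_map, List.sum_ofFn]

theorem input_tables (i : Fin A.numOps) {u : ℕ} (hu : u < A.card ^ A.arity i) :
    (RAM.inputState A).arr 1 (A.offset i + u) = A.opEntry i u := by
  have hd : (List.finRange A.numOps).drop i = i :: (List.finRange A.numOps).drop (i + 1) := by
    rw [List.drop_eq_getElem_cons (by simp)]
    simp
  have hl : (((List.finRange A.numOps).take i).flatMap fun j => opTable (A.op j)).length
      = A.offset i := by
    simp [List.length_flatMap, offset, opTable_length]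
  have hf : (List.finRange A.numOps).flatMap (fun j => opTable (A.op j)) =
      ((List.finRange A.numOps).take i).flatMap (fun j => opTable (A.op j)) ++
        (opTable (A.op i) ++
          ((List.finRange A.numOps).drop (i + 1)).flatMap fun j => opTable (A.op j)) := by
    rw [← List.flatMap_cons (f := fun j => opTable (A.op j)), ← hd, ← List.flatMap_append,
      List.take_append_drop]
  simp only [RAM.inputState, one_ne_zero, if_false, if_true, hf, opEntry]
  rw [List.getD_append_right _ _ _ _ (by omega), hl, Nat.add_sub_cancel_left,
    List.getD_append _ _ _ _ (by rwa [opTable_length])]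

theorem input_arity (i : Fin A.numOps) : (RAM.inputState A).arr 0 i = A.arity i := by
  simp [RAM.inputState, List.getD_eq_getElem?_getD]

/-! ### Positions x + y n + z n² in a ternary table. -/

theorem index_lt {n x y z : ℕ} (hx : x < n) (hy : y < n) (hz : z < n) :
    x + y * n + z * n * n < n * n * n := by
  have h₁ : (y + z * n) + 1 ≤ n * n := by
    have := Nat.mul_le_mul_right n (Nat.succ_le_of_lt hz)
    rw [Nat.succ_mul] at this
    omega
  have := Nat.mul_le_mul_right n h₁
  rw [Nat.add_mul, Nat.add_mul] at this
  omega

theorem index_mod {n x y z : ℕ} (hx : x < n) : (x + y * n + z * n * n) % n = x := by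
  rw [show x + y * n + z * n * n = x + n * (y + z * n) by ring, Nat.add_mul_mod_self_left,
    Nat.mod_eq_of_lt hx]

theorem index_div {n x y z : ℕ} (hx : x < n) : (x + y * n + z * n * n) / n = y + z * n := by
  rw [show x + y * n + z * n * n = x + n * (y + z * n) by ring,
    Nat.add_mul_div_left _ _ (by omega), Nat.div_eq_of_lt hx, zero_add]

theorem index_div_mod {n x y z : ℕ} (hx : x < n) (hy : y < n) :
    (x + y * n + z * n * n) / n % n = y := by
  rw [index_div hx, Nat.add_mul_mod_self_right, Nat.mod_eq_of_lt hy]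

theorem index_div_div {n x y z : ℕ} (hx : x < n) (hy : y < n) :
    (x + y * n + z * n * n) / n / n = z := by
  rw [index_div hx, Nat.add_mul_div_right _ _ (by omega), Nat.div_eq_of_lt hy, zero_add]

theorem index_digits (n p : ℕ) : p % n + p / n % n * n + p / n / n * n * n = p := by
  have h₁ := Nat.mod_add_div' p n
  have h₂ := Nat.mod_add_div' (p / n) n
  rw [add_assoc, ← add_mul, h₂, h₁]

theorem div_div_lt {n p : ℕ} (hp : p < n * n * n) : p / n / n < n := by
  rw [Nat.div_div_eq_div_mul]
  exact Nat.div_lt_of_lt_mul hp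

/-! ### Closure properties of tables of ternary term operations. -/

theorem TermTable.exists_eq {g : ℕ → ℕ} (hg : A.TermTable g) :
    ∃ t : A.lang.Term (Fin 3), ∀ (x y z : A.Carrier),
      g (x + y * A.card + z * A.card * A.card) = t.realize (![x, y, z]) := by
  obtain ⟨t, ht⟩ := hg
  exact ⟨t, fun x y z => ht ![x, y, z]⟩

theorem TermTable.lt {g : ℕ → ℕ} (hg : A.TermTable g) {p : ℕ}
    (hp : p < A.card * A.card * A.card) : g p < A.card := by
  have hn : 0 < A.card := Nat.pos_of_ne_zero fun h => by simp [h] at hp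
  obtain ⟨t, ht⟩ := hg.exists_eq
  have := ht ⟨p % A.card, Nat.mod_lt _ hn⟩ ⟨p / A.card % A.card, Nat.mod_lt _ hn⟩
    ⟨p / A.card / A.card, div_div_lt hp⟩
  simp only [index_digits] at this
  rw [this]
  exact Fin.isLt _

theorem TermTable.congr {g h : ℕ → ℕ} (hg : A.TermTable g)
    (e : ∀ p < A.card * A.card * A.card, h p = g p) : A.TermTable h := by
  obtain ⟨t, ht⟩ := hg
  exact ⟨t, fun v => by rw [← ht, e _ (index_lt (v 0).2 (v 1).2 (v 2).2)]⟩

theorem termTable_fst : A.TermTable fun p => p % A.card :=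
  ⟨.var 0, fun v => index_mod (v 0).2⟩

theorem termTable_snd : A.TermTable fun p => p / A.card % A.card :=
  ⟨.var 1, fun v => index_div_mod (v 0).2 (v 1).2⟩

theorem termTable_thd : A.TermTable fun p => p / A.card / A.card :=
  ⟨.var 2, fun v => index_div_div (v 0).2 (v 1).2⟩

theorem TermTable.comp {r g₀ g₁ g₂ : ℕ → ℕ} (hr : A.TermTable r) (h₀ : A.TermTable g₀)
    (h₁ : A.TermTable g₁) (h₂ : A.TermTable g₂) :
    A.TermTable fun p => r (g₀ p + g₁ p * A.card + g₂ p * A.card * A.card) := by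
  obtain ⟨t, ht⟩ := hr.exists_eq
  obtain ⟨t₀, ht₀⟩ := h₀
  obtain ⟨t₁, ht₁⟩ := h₁
  obtain ⟨t₂, ht₂⟩ := h₂
  refine ⟨t.subst (![t₀, t₁, t₂]), fun v => ?_⟩
  simp only [ht₀, ht₁, ht₂, ht, Language.Term.realize_subst]
  congr 2
  funext i
  fin_cases i <;> rfl

/-- The base-n digits of `d p` are the values of the argument tables at `p`, so composition with a
basic operation is one lookup per position. -/
theorem termTable_op (i : Fin A.numOps) {g : ℕ → ℕ → ℕ} {d : ℕ → ℕ}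
    (hg : ∀ j < A.arity i, A.TermTable (g j))
    (hd : ∀ p < A.card * A.card * A.card, d p < A.card ^ A.arity i ∧
      ∀ j < A.arity i, d p / A.card ^ j % A.card = g j p) :
    A.TermTable fun p => A.opEntry i (d p) := by
  choose t ht using hg
  refine ⟨.func ⟨i, rfl⟩ fun j => t j j.2, fun v => ?_⟩
  obtain ⟨h₁, h₂⟩ := hd _ (index_lt (v 0).2 (v 1).2 (v 2).2)
  change A.opEntry i (d _) = _
  rw [opEntry_eq h₁ (fun j => (t j j.2).realize v) fun j => by rw [h₂ j j.2, ht j j.2] ]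
  rfl

/-- The values at positions `P` and `Q` of every table of a term operation lie in every set of
pairs that contains the values of the projections and is closed under the basic operations. -/
theorem TermTable.key_mem {S : ℕ → Prop} {P Q : ℕ} (hP : P < A.card * A.card * A.card)
    (hQ : Q < A.card * A.card * A.card)
    (h₀ : S (P % A.card * A.card + Q % A.card))
    (h₁ : S (P / A.card % A.card * A.card + Q / A.card % A.card))
    (h₂ : S (P / A.card / A.card * A.card + Q / A.card / A.card))
    (hop : ∀ (i : Fin A.numOps) (u v : ℕ), u < A.card ^ A.arity i → v < A.card ^ A.arity i →
      (∀ j < A.arity i, S (u / A.card ^ j % A.card * A.card + v / A.card ^ j % A.card)) →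
      S (A.opEntry i u * A.card + A.opEntry i v))
    {g : ℕ → ℕ} (hg : A.TermTable g) : S (g P * A.card + g Q) := by
  have hn : 0 < A.card := Nat.pos_of_ne_zero fun h => by simp [h] at hP
  obtain ⟨t, ht⟩ := hg.exists_eq
  let a : ℕ → Fin 3 → A.Carrier := fun p =>
    ![⟨p % A.card, Nat.mod_lt _ hn⟩, ⟨p / A.card % A.card, Nat.mod_lt _ hn⟩,
      ⟨p / A.card / A.card % A.card, Nat.mod_lt _ hn⟩]
  have ha : ∀ {p}, p < A.card * A.card * A.card → g p = t.realize (a p) := fun {p} hp => by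
    have := ht (a p 0) (a p 1) (a p 2)
    simp only [a, Matrix.cons_val, Nat.mod_eq_of_lt (div_div_lt hp), index_digits] at this
    rw [this]
    simp [a, Nat.mod_eq_of_lt (div_div_lt hp)]
  rw [ha hP, ha hQ]
  clear ha ht hg
  induction t with
  | var j =>
    fin_cases j
    · exact h₀
    · exact h₁
    · simpa [a, Nat.mod_eq_of_lt (div_div_lt hP), Nat.mod_eq_of_lt (div_div_lt hQ)] using h₂
  | func f ts ih =>
    obtain ⟨i, rfl⟩ := f
    -- The values of the subterms at the point `a p`, packed into one position of the table of the
    -- operation.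
    let u (p : ℕ) := finFunctionFinEquiv fun j => (ts j).realize (a p)
    have hu : ∀ p (j : Fin (A.arity i)), (u p : ℕ) / A.card ^ (j : ℕ) % A.card
        = (ts j).realize (a p) := fun p j => by
      rw [← finFunctionFinEquiv_symm_val, Equiv.symm_apply_apply]
    have := hop i (u P) (u Q) (u P).2 (u Q).2 fun j hj => by
      rw [hu P ⟨j, hj⟩, hu Q ⟨j, hj⟩]
      exact ih ⟨j, hj⟩
    rwa [opEntry_eq (u P).2 _ (hu P), opEntry_eq (u Q).2 _ (hu Q)] at this

/-- Induction on terms. Idempotence of the algebra enters the correctness proof only through this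
fact. -/
theorem TermTable.idem (hA : A.IsIdempotent) {g : ℕ → ℕ} (hg : A.TermTable g) {x : ℕ}
    (hx : x < A.card) : g (x + x * A.card + x * A.card * A.card) = x := by
  obtain ⟨t, ht⟩ := hg
  have key : t.realize (fun _ => (⟨x, hx⟩ : A.Carrier)) = ⟨x, hx⟩ := by
    clear ht
    induction t with
    | var _ => rfl
    | func f ts ih =>
      rw [Language.Term.realize_func]
      simp only [ih]
      exact hA f.1 _
  have := ht fun _ => ⟨x, hx⟩
  rwa [key] at this

/-- The entries of `g` form the table of a Maltsev term operation. -/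
structure MaltsevTable (A : FinAlgebra) (g : ℕ → ℕ) : Prop where
  term : A.TermTable g
  right : ∀ x < A.card, ∀ y < A.card, g (x + x * A.card + y * A.card * A.card) = y
  left : ∀ x < A.card, ∀ y < A.card, g (y + x * A.card + x * A.card * A.card) = y

theorem finFunctionFinEquiv_three {n : ℕ} (v : Fin 3 → Fin n) :
    (finFunctionFinEquiv v : ℕ) = v 0 + v 1 * n + v 2 * n * n := by
  rw [finFunctionFinEquiv_apply, Fin.sum_univ_three]
  simp [pow_two, mul_assoc]

theorem IsMaltsevTermOperation.exists_table {m : (Fin 3 → A.Carrier) → A.Carrier}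
    (hm : A.IsMaltsevTermOperation m) : ∃ g, A.MaltsevTable g := by
  obtain ⟨⟨t, ht⟩, hm⟩ := hm
  have key : ∀ v : Fin 3 → A.Carrier,
      (opTable m).getD (v 0 + v 1 * A.card + v 2 * A.card * A.card) 0 = m v := fun v => by
    rw [← finFunctionFinEquiv_three, opTable_getD]
  refine ⟨fun p => (opTable m).getD p 0, ⟨t, fun v => ?_⟩, fun x hx y hy => ?_,
    fun x hx y hy => ?_⟩
  · exact (key v).trans (congrArg _ (ht v).symm)
  · have := key ![⟨x, hx⟩, ⟨x, hx⟩, ⟨y, hy⟩]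
    rw [(hm _ _).1] at this
    exact this
  · have := key ![⟨y, hy⟩, ⟨x, hx⟩, ⟨x, hx⟩]
    rw [(hm _ _).2] at this
    exact this

theorem MaltsevTable.exists_operation {g : ℕ → ℕ} (hg : A.MaltsevTable g) :
    ∃ m, A.IsMaltsevTermOperation m ∧
      (List.range (opTable m).length).map g = opTable m := by
  obtain ⟨t, ht⟩ := hg.term
  refine ⟨fun v => t.realize v, ⟨⟨t, fun _ => rfl⟩, fun x y => ⟨?_, ?_⟩⟩, ?_⟩
  · apply Fin.ext
    rw [← ht]
    exact hg.right x x.2 y y.2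
  · apply Fin.ext
    rw [← ht]
    exact hg.left x x.2 y y.2
  · apply List.ext_getElem
    · simp
    · intro c h₁ h₂
      rw [opTable_length] at h₂
      simp only [opTable, List.getElem_map, List.getElem_range, List.getElem_ofFn, ← ht,
        ← finFunctionFinEquiv_three, Equiv.apply_symm_apply]

/-- This case is split off because for n = 1 the arities are not bounded by the size, so loops over
arguments would not be polynomial. -/
theorem isMaltsevTermOperation_of_card_le_one (h : A.card ≤ 1) :
    A.IsMaltsevTermOperation fun v => v 0 := by
  have : Subsingleton A.Carrier := Fin.subsingleton_iff_le_one.2 h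
  exact ⟨⟨.var 0, fun _ => rfl⟩, fun _ _ => ⟨Subsingleton.elim _ _, Subsingleton.elim _ _⟩⟩

end FinAlgebra

/-! ## Registers and arrays of the program -/

notation "rCard" => (0 : ℕ)
notation "rNumOps" => (1 : ℕ)
notation "rSq" => (2 : ℕ)
notation "rCube" => (3 : ℕ)
notation "rLen" => (4 : ℕ)
notation "rZero" => (5 : ℕ)
notation "rPow" => (6 : ℕ)
notation "rAcc" => (7 : ℕ)
notation "rExp" => (8 : ℕ)
notation "rJ" => (9 : ℕ)
notation "rR" => (10 : ℕ)
notation "rOp" => (11 : ℕ)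
notation "rOff" => (12 : ℕ)
notation "rCnt" => (13 : ℕ)
notation "rQ" => (14 : ℕ)
notation "rPos" => (15 : ℕ)
notation "rPosA" => (16 : ℕ)
notation "rPosB" => (17 : ℕ)
notation "rKey" => (18 : ℕ)
notation "rBase" => (19 : ℕ)
notation "rOk" => (20 : ℕ)
notation "rRestU" => (21 : ℕ)
notation "rRestV" => (22 : ℕ)
notation "rIdx" => (23 : ℕ)
notation "rU" => (24 : ℕ)
notation "rV" => (25 : ℕ)
notation "rRound" => (26 : ℕ)
notation "rRounds" => (27 : ℕ)
notation "rOuter" => (28 : ℕ)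
notation "rInner" => (29 : ℕ)
notation "rA" => (30 : ℕ)
notation "rB" => (31 : ℕ)
notation "rTabb" => (32 : ℕ)
notation "rC" => (33 : ℕ)
notation "rD" => (34 : ℕ)
notation "rSccd" => (35 : ℕ)
notation "rFail" => (36 : ℕ)

notation "aArity" => (0 : ℕ)
notation "aTables" => (1 : ℕ)
notation "aMain" => (2 : ℕ)
notation "aSide" => (3 : ℕ)
notation "aPresent" => (4 : ℕ)
notation "aPool" => (5 : ℕ)
notation "aScratch" => (6 : ℕ)
notation "aMul" => (7 : ℕ)
notation "aDiv" => (8 : ℕ)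
notation "aMod" => (9 : ℕ)
notation "aPow" => (10 : ℕ)
notation "aOff" => (11 : ℕ)
notation "aDigit" => (12 : ℕ)

infixr:60 " ⨟ " => RAM.Prog.seq

open RAM.Prog RAM.Expr

namespace RAM

/-! ## Precomputed tables for arithmetic -/

/-- `rPow := rCard ^ rExp`. -/
def powProg : Prog :=
  assign rPow (const 1) ⨟
  for_ rJ rExp (
    assign rAcc (const 0) ⨟
    for_ rR rCard (assign rAcc (add (reg rAcc) (reg rPow))) ⨟
    assign rPow (reg rAcc))

/-- Computes the lengths and the offsets of the operation tables. -/
def offsetProg : Prog :=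
  for_ rOp rNumOps (
    assign rExp (read aArity (reg rOp)) ⨟
    powProg ⨟
    write aPow (reg rOp) (reg rPow) ⨟
    write aOff (reg rOp) (reg rOff) ⨟
    assign rOff (add (reg rOff) (reg rPow)))

/-- Computes `rCard ^ 2`, `rCard ^ 3` and the length of the arithmetical tables. -/
def powersProg : Prog :=
  assign rExp (const 2) ⨟ powProg ⨟ assign rSq (reg rPow) ⨟
  assign rExp (const 3) ⨟ powProg ⨟ assign rCube (reg rPow) ⨟
  assign rExp (const 4) ⨟ powProg ⨟ assign rLen (add (reg rPow) (reg rOff))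

/-- Tabulates `j ↦ j * n`, `j ↦ j / n` and `j ↦ j % n`, where `n` is the content of `rCard`. -/
def arithProg : Prog :=
  for_ rQ rLen (
    write aMul (reg rQ) (reg rCnt) ⨟
    for_ rR rCard (
      write aDiv (reg rCnt) (reg rQ) ⨟
      write aMod (reg rCnt) (reg rR) ⨟
      assign rCnt (add (reg rCnt) (const 1))))

/-- All precomputation. -/
def setupProg : Prog := offsetProg ⨟ powersProg ⨟ arithProg

variable {W : ℕ} {s : State} {A : FinAlgebra}

theorem powProg_spec {n k : ℕ} (hn : s.reg rCard = n) (hk : s.reg rExp = k) (hnW : n ≤ W)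
    (hkW : k ≤ W) : wp W powProg (fun s' => s'.reg rPow = n ^ k) s := by
  apply wp_seq
  apply wp_assign
  refine wp_for (fun j s₁ => s₁.reg rPow = n ^ j) hkW (by simp [hk]) rfl rfl (by simp [eval]) ?_
    fun s₁ _ h => h
  intro j s₁ hj hf hj₁ hI
  have hn₁ : s₁.reg rCard = n := by rw [hf.reg rCard rfl]; simp [hn]
  apply wp_seq
  apply wp_assign
  apply wp_seq
  refine wp_for (fun r s₂ => s₂.reg rAcc = r * n ^ j) hnW (by simp [hn₁]) rfl rfl
    (by simp [eval]) ?_ ?_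
  · intro r s₂ hr hf₂ hr₂ hI₂
    apply wp_assign
    have : s₂.reg rPow = n ^ j := by rw [hf₂.reg rPow rfl]; simp [hI]
    simp [eval, hI₂, this, Nat.succ_mul]
  · intro s₂ _ h
    apply wp_assign
    simp [eval, h, pow_succ, mul_comm]

/-- The length of the arithmetical tables. -/
def arithLength (A : FinAlgebra) : ℕ := A.card ^ 4 + A.size

/-- A bound for the number of iterations of each loop. -/
def loopBound (A : FinAlgebra) : ℕ := arithLength A + 1

theorem pow_arity_le_size (i : Fin A.numOps) : A.card ^ A.arity i ≤ A.size :=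
  Finset.single_le_sum (f := fun i => A.card ^ A.arity i) (fun _ _ => Nat.zero_le _)
    (Finset.mem_univ i)

theorem arity_le_size (hn : 2 ≤ A.card) (i : Fin A.numOps) : A.arity i ≤ A.size :=
  (Nat.lt_pow_self hn).le.trans (pow_arity_le_size i)

theorem numOps_le_size (hn : 2 ≤ A.card) : A.numOps ≤ A.size := by
  have : ∑ _i : Fin A.numOps, 1 ≤ A.size :=
    Finset.sum_le_sum fun i _ => Nat.one_le_pow _ _ (by omega)
  simpa using this

theorem card_le_arithLength : A.card ≤ arithLength A :=
  (Nat.le_self_pow (by norm_num) _).trans (Nat.le_add_right _ _)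

theorem sq_le_arithLength : A.card * A.card ≤ arithLength A := by
  refine le_trans ?_ (Nat.le_add_right _ _)
  rcases Nat.eq_zero_or_pos A.card with h | h
  · simp [h]
  · rw [← pow_two]; exact Nat.pow_le_pow_right h (by norm_num)

theorem cube_le_arithLength : A.card * A.card * A.card ≤ arithLength A := by
  refine le_trans ?_ (Nat.le_add_right _ _)
  rcases Nat.eq_zero_or_pos A.card with h | h
  · simp [h]
  · rw [← pow_two, ← pow_succ]; exact Nat.pow_le_pow_right h (by norm_num)

theorem fourth_le_arithLength : A.card * A.card * A.card * A.card ≤ arithLength A := by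
  rw [← pow_two, ← pow_succ, ← pow_succ]
  exact Nat.le_add_right _ _

theorem pow_arity_le_arithLength (i : Fin A.numOps) : A.card ^ A.arity i ≤ arithLength A :=
  (pow_arity_le_size i).trans (Nat.le_add_left _ _)

theorem offsetProg_spec (hn : 2 ≤ A.card) (hs : s = inputState A) :
    wp (loopBound A) offsetProg (fun s' => s'.reg rOff = A.size ∧ ∀ i : Fin A.numOps,
      s'.arr aPow i = A.card ^ A.arity i ∧ s'.arr aOff i = A.offset i) s := by
  have hc : A.card ≤ loopBound A := card_le_arithLength.trans (Nat.le_succ _)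
  have hsize : A.size ≤ loopBound A := (Nat.le_add_left _ _).trans (Nat.le_succ _)
  refine wp_for (fun k s₁ => s₁.reg rOff = A.offset k ∧ ∀ i : Fin A.numOps, i < k →
      s₁.arr aPow i = A.card ^ A.arity i ∧ s₁.arr aOff i = A.offset i)
    ((numOps_le_size hn).trans hsize) (by simp [hs, inputState]) rfl rfl ?_ ?_ ?_
  · simp [hs, inputState, FinAlgebra.offset_zero]
  · rintro k s₁ hk hf hk₁ ⟨h₁, h₂⟩
    apply wp_seq
    apply wp_assign
    apply wp_seq
    have hcard : s₁.reg rCard = A.card := by rw [hf.reg rCard rfl]; simp [hs, inputState]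
    have harity : s₁.arr aArity k = A.arity ⟨k, hk⟩ := by
      rw [hf.arr aArity rfl, hs]; exact FinAlgebra.input_arity ⟨k, hk⟩
    refine (powProg_spec (n := A.card) (k := A.arity ⟨k, hk⟩) ?_ ?_ hc
      ((arity_le_size hn _).trans hsize)).mono fun s₂ hf₂ hp => ?_
    · simp [hcard]
    · simp [eval, hk₁, harity]
    have e₁ : s₂.reg rOp = k := by rw [hf₂.reg rOp rfl]; simp [hk₁]
    have e₂ : s₂.reg rOff = A.offset k := by rw [hf₂.reg rOff rfl]; simp [h₁]
    have e₃ : s₂.arr aPow = s₁.arr aPow := by rw [hf₂.arr aPow rfl]; rfl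
    have e₄ : s₂.arr aOff = s₁.arr aOff := by rw [hf₂.arr aOff rfl]; rfl
    apply wp_seq
    apply wp_write
    apply wp_seq
    apply wp_write
    apply wp_assign
    simp only [eval, State.setReg_reg, State.setArr_reg, State.setReg_arr, State.setArr_arr, hp,
      e₁, e₂, e₃, e₄]
    refine ⟨by simpa using (FinAlgebra.offset_succ ⟨k, hk⟩).symm, fun i hi => ?_⟩
    rcases Nat.lt_succ_iff_lt_or_eq.1 hi with hi' | rfl
    · simp [Function.update_of_ne hi'.ne, h₂ i hi']
    · simp
  · rintro s₁ - ⟨h₁, h₂⟩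
    exact ⟨h₁.trans FinAlgebra.offset_numOps, fun i => h₂ i i.2⟩

theorem powersProg_spec {n : ℕ} (hc : s.reg rCard = n) (hW : n ≤ W) (hW₄ : 4 ≤ W) :
    wp W powersProg (fun s' => s'.reg rSq = n * n ∧ s'.reg rCube = n * n * n ∧
      s'.reg rLen = n ^ 4 + s.reg rOff) s := by
  apply wp_seq
  apply wp_assign
  apply wp_seq
  refine (powProg_spec (n := n) (k := 2) (by simp [hc]) (by simp [eval]) hW
    (by omega)).mono fun s₁ hf₁ h₁ => ?_
  apply wp_seq
  apply wp_assign
  apply wp_seq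
  apply wp_assign
  apply wp_seq
  have hc₁ : s₁.reg rCard = n := by rw [hf₁.reg rCard rfl]; simp [hc]
  refine (powProg_spec (n := n) (k := 3) (by simp [hc₁]) (by simp [eval]) hW
    (by omega)).mono fun s₂ hf₂ h₂ => ?_
  apply wp_seq
  apply wp_assign
  apply wp_seq
  apply wp_assign
  apply wp_seq
  have hc₂ : s₂.reg rCard = n := by rw [hf₂.reg rCard rfl]; simp [hc₁]
  refine (powProg_spec (n := n) (k := 4) (by simp [hc₂]) (by simp [eval]) hW
    hW₄).mono fun s₃ hf₃ h₃ => ?_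
  apply wp_assign
  have e₁ : s₃.reg rSq = n * n := by
    rw [hf₃.reg rSq rfl]; simp [hf₂.reg rSq rfl, eval, h₁, pow_two]
  have e₂ : s₃.reg rCube = n * n * n := by
    rw [hf₃.reg rCube rfl]; simp [eval, h₂, pow_succ]
  have e₃ : s₃.reg rOff = s.reg rOff := by
    rw [hf₃.reg rOff rfl]; simp [hf₂.reg rOff rfl, hf₁.reg rOff rfl]
  simp [eval, h₃, e₁, e₂, e₃]

/-- A single counter runs through q n + r. At each value q and r are the quotient and the remainder,
and at the start of row q the counter is the product q n. -/
theorem arithProg_spec {n L : ℕ} (hn : 0 < n) (hc : s.reg rCard = n) (hL : s.reg rLen = L)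
    (h0 : s.reg rCnt = 0) (hnW : n ≤ W) (hLW : L ≤ W) :
    wp W arithProg (fun s' => ∀ j < L, s'.arr aMul j = j * n ∧ s'.arr aDiv j = j / n ∧
      s'.arr aMod j = j % n) s := by
  refine wp_for (fun q s₁ => s₁.reg rCnt = q * n ∧ (∀ j < q, s₁.arr aMul j = j * n) ∧
      ∀ j < q * n, s₁.arr aDiv j = j / n ∧ s₁.arr aMod j = j % n) hLW hL rfl rfl ?_ ?_ ?_
  · simp [h0]
  · rintro q s₁ hq hf hq₁ ⟨h₁, h₂, h₃⟩
    have hn₁ : s₁.reg rCard = n := by rw [hf.reg rCard rfl, hc]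
    apply wp_seq
    apply wp_write
    refine wp_for (fun r s₂ => s₂.reg rCnt = q * n + r ∧
      ∀ j < q * n + r, s₂.arr aDiv j = j / n ∧ s₂.arr aMod j = j % n) hnW (by simp [hn₁]) rfl rfl
      ?_ ?_ ?_
    · simpa [h₁] using h₃
    · rintro r s₂ hr hf₂ hr₂ ⟨h₄, h₅⟩
      have hq₂ : s₂.reg rQ = q := by rw [hf₂.reg rQ rfl]; simp [hq₁]
      apply wp_seq
      apply wp_write
      apply wp_seq
      apply wp_write
      apply wp_assign
      simp only [eval, State.setReg_reg, State.setArr_reg, State.setReg_arr, State.setArr_arr,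
        h₄, hq₂, hr₂]
      refine ⟨by simp; omega, fun j hj => ?_⟩
      rcases Nat.lt_or_eq_of_le (show j ≤ q * n + r by omega) with hj' | rfl
      · simp [Function.update_of_ne hj'.ne, h₅ j hj']
      · simp [Nat.mod_eq_of_lt hr, mul_comm q n, Nat.mul_add_div hn, Nat.div_eq_of_lt hr]
    · rintro s₂ hf₂ ⟨h₄, h₅⟩
      refine ⟨by simp [h₄, Nat.succ_mul], fun j hj => ?_, fun j hj => h₅ j ?_⟩
      · rw [State.setReg_arr, hf₂.arr aMul rfl]
        rcases Nat.lt_succ_iff_lt_or_eq.1 hj with hj' | rfl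
        · simp [eval, hq₁, Function.update_of_ne hj'.ne, h₂ j hj']
        · simp [eval, hq₁, h₁]
      · rwa [Nat.succ_mul] at hj
  · rintro s₁ - ⟨-, h₂, h₃⟩ j hj
    exact ⟨h₂ j hj, h₃ j (hj.trans_le (Nat.le_mul_of_pos_right _ hn))⟩

/-- The part of the state that is fixed after the precomputation. -/
structure Env (A : FinAlgebra) (s : State) : Prop where
  card : s.reg rCard = A.card
  numOps : s.reg rNumOps = A.numOps
  sq : s.reg rSq = A.card * A.card
  cube : s.reg rCube = A.card * A.card * A.card
  zero : s.reg rZero = 0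
  arity : ∀ i : Fin A.numOps, s.arr aArity i = A.arity i
  tables : ∀ (i : Fin A.numOps) (u : ℕ), u < A.card ^ A.arity i →
    s.arr aTables (A.offset i + u) = A.opEntry i u
  pow : ∀ i : Fin A.numOps, s.arr aPow i = A.card ^ A.arity i
  off : ∀ i : Fin A.numOps, s.arr aOff i = A.offset i
  mul : ∀ j < arithLength A, s.arr aMul j = j * A.card
  div : ∀ j < arithLength A, s.arr aDiv j = j / A.card
  mod : ∀ j < arithLength A, s.arr aMod j = j % A.card

theorem setupProg_spec (hn : 2 ≤ A.card) :
    wp (loopBound A) setupProg (Env A) (inputState A) := by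
  have hc : A.card ≤ loopBound A := card_le_arithLength.trans (Nat.le_succ _)
  -- `powersProg` computes n⁴ with a loop of four iterations.
  have h₄ : 4 ≤ loopBound A := by
    have := sq_le_arithLength (A := A)
    have := Nat.mul_le_mul hn hn
    unfold loopBound
    omega
  apply wp_seq
  refine (offsetProg_spec hn rfl).mono fun s₁ hf₁ ⟨h₁, h₁'⟩ => ?_
  apply wp_seq
  refine (powersProg_spec (n := A.card) (by rw [hf₁.reg rCard rfl]; simp [inputState]) hc
    h₄).mono fun s₂ hf₂ ⟨h₂, h₂', h₂''⟩ => ?_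
  refine (arithProg_spec (n := A.card) (L := arithLength A) (by omega) ?_ (by rw [h₂'', h₁]; rfl)
    ?_ hc (Nat.le_succ _)).mono fun s₃ hf₃ h₃ => ?_
  · rw [hf₂.reg rCard rfl, hf₁.reg rCard rfl]; simp [inputState]
  · rw [hf₂.reg rCnt rfl, hf₁.reg rCnt rfl]; simp [inputState]
  · refine ⟨?_, ?_, ?_, ?_, ?_, fun i => ?_, fun i u hu => ?_, fun i => ?_, fun i => ?_,
      fun j hj => (h₃ j hj).1, fun j hj => (h₃ j hj).2.1, fun j hj => (h₃ j hj).2.2⟩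
    · rw [hf₃.reg _ rfl, hf₂.reg _ rfl, hf₁.reg _ rfl]; simp [inputState]
    · rw [hf₃.reg _ rfl, hf₂.reg _ rfl, hf₁.reg _ rfl]; simp [inputState]
    · rw [hf₃.reg _ rfl, h₂]
    · rw [hf₃.reg _ rfl, h₂']
    · rw [hf₃.reg _ rfl, hf₂.reg _ rfl, hf₁.reg _ rfl]; simp [inputState]
    · rw [hf₃.arr _ rfl, hf₂.arr _ rfl, hf₁.arr _ rfl, FinAlgebra.input_arity]
    · rw [hf₃.arr _ rfl, hf₂.arr _ rfl, hf₁.arr _ rfl, FinAlgebra.input_tables i hu]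
    · rw [hf₃.arr _ rfl, hf₂.arr _ rfl, (h₁' i).1]
    · rw [hf₃.arr _ rfl, hf₂.arr _ rfl, (h₁' i).2]

end RAM

namespace RAM

/-! ## Closing a set of pairs under the basic operations -/

/-- Whether `p` leaves everything fixed by `Env` untouched. -/
def Prog.preservesEnv (p : Prog) : Bool :=
  [rCard, rNumOps, rSq, rCube, rZero].all (fun x => !p.writesReg x) &&
    [aArity, aTables, aMul, aDiv, aMod, aPow, aOff].all (fun a => !p.writesArr a)

/-- First coordinate of the position in `rPos`. -/
def fstExpr : Expr := read aMod (reg rPos)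

/-- Second coordinate of the position in `rPos`. -/
def sndExpr : Expr := read aMod (read aDiv (reg rPos))

/-- Third coordinate of the position in `rPos`. -/
def thdExpr : Expr := read aDiv (read aDiv (reg rPos))

/-- The position with coordinates `e₁, e₂, e₃`. -/
def indexExpr (e₁ e₂ e₃ : Expr) : Expr :=
  add (add e₁ (read aMul e₂)) (read aMul (read aMul e₃))

/-- Where the table for the pair with code `e` starts in the pool. -/
def baseExpr (e : Expr) : Expr := read aMul (read aMul (read aMul e))

/-- Tabulates an expression in `rPos`. -/
def tabulate (a : ℕ) (e : Expr) : Prog := fill rPos rCube a rZero e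

/-- Adds the table in `aScratch` to the pool. -/
def storeProg : Prog :=
  assign rKey (add (read aMul (read aScratch (reg rPosA))) (read aScratch (reg rPosB))) ⨟
  assign rBase (baseExpr (reg rKey)) ⨟
  fill rPos rCube aPool rBase (read aScratch (reg rPos)) ⨟
  write aPresent (reg rKey) (const 1)

/-- Reads off a tuple of pairs from two positions of an operation table, and checks that the pool
has a table for each of them. -/
def digitsProg : Prog :=
  assign rOk (const 1) ⨟
  assign rRestU (reg rU) ⨟
  assign rRestV (reg rV) ⨟
  for_ rJ rExp (
    assign rKey (add (read aMul (read aMod (reg rRestU))) (read aMod (reg rRestV))) ⨟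
    write aDigit (reg rJ) (baseExpr (reg rKey)) ⨟
    ite (read aPresent (reg rKey)) skip (assign rOk (const 0)) ⨟
    assign rRestU (read aDiv (reg rRestU)) ⨟
    assign rRestV (read aDiv (reg rRestV)))

/-- Applies a basic operation to a tuple of tables from the pool. -/
def applyProg : Prog :=
  for_ rPos rCube (
    assign rIdx (const 0) ⨟
    for_ rJ rExp (
      assign rIdx (add (read aMul (reg rIdx))
        (read aPool (add (read aDigit (sub (sub (reg rExp) (const 1)) (reg rJ))) (reg rPos))))) ⨟
    write aScratch (reg rPos) (read aTables (add (reg rOff) (reg rIdx))))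

/-- Processes one tuple of pairs. -/
def stepProg : Prog := digitsProg ⨟ ite (reg rOk) (applyProg ⨟ storeProg) skip

/-- Processes all tuples of pairs for all basic operations. -/
def roundProg : Prog :=
  for_ rOp rNumOps (
    assign rExp (read aArity (reg rOp)) ⨟
    assign rPow (read aPow (reg rOp)) ⨟
    assign rOff (read aOff (reg rOp)) ⨟
    for_ rU rPow (for_ rV rPow stepProg))

/-- Computes tables of term operations for all pairs of values at `rPosA` and `rPosB`. -/
def searchProg : Prog :=
  fill rPos rSq aPresent rZero (const 0) ⨟
  tabulate aScratch fstExpr ⨟ storeProg ⨟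
  tabulate aScratch sndExpr ⨟ storeProg ⨟
  tabulate aScratch thdExpr ⨟ storeProg ⨟
  assign rRounds (add (reg rSq) (const 1)) ⨟
  for_ rRound rRounds roundProg

variable {W : ℕ} {s s' : State} {A : FinAlgebra} {P Q : ℕ}

/-! ### Stability of the precomputed data and evaluation of address expressions. -/

theorem Env.congr (h : Env A s)
    (hr : ∀ x ∈ [rCard, rNumOps, rSq, rCube, rZero], s'.reg x = s.reg x)
    (ha : ∀ a ∈ [aArity, aTables, aMul, aDiv, aMod, aPow, aOff], s'.arr a = s.arr a) :
    Env A s' := by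
  simp only [List.mem_cons, List.not_mem_nil, or_false, forall_eq_or_imp, forall_eq] at hr ha
  obtain ⟨r₁, r₂, r₃, r₄, r₅⟩ := hr
  obtain ⟨a₁, a₂, a₃, a₄, a₅, a₆, a₇⟩ := ha
  constructor <;> simp only [r₁, r₂, r₃, r₄, r₅, a₁, a₂, a₃, a₄, a₅, a₆, a₇]
  exacts [h.card, h.numOps, h.sq, h.cube, h.zero, h.arity, h.tables, h.pow, h.off, h.mul, h.div,
    h.mod]

theorem Env.frame (h : Env A s) {p : Prog} (hf : Frame p s s') (hp : p.preservesEnv = true) :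
    Env A s' := by
  simp only [preservesEnv, Bool.and_eq_true, List.all_eq_true, Bool.not_eq_true'] at hp
  exact h.congr (fun x hx => hf.reg x (hp.1 x hx)) fun a ha => hf.arr a (hp.2 a ha)

theorem Env.setReg (h : Env A s) {x v : ℕ} (hx : x ∉ [rCard, rNumOps, rSq, rCube, rZero]) :
    Env A (s.setReg x v) :=
  h.congr (fun y hy => by rw [State.setReg_reg, if_neg (by rintro rfl; exact hx hy)])
    fun _ _ => rfl

theorem Env.fill {i a : ℕ} (h : Env A s) (hr : ∀ x ≠ i, s'.reg x = s.reg x)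
    (ha : ∀ c ≠ a, s'.arr c = s.arr c) (hi : i ∉ [rCard, rNumOps, rSq, rCube, rZero])
    (haa : a ∉ [aArity, aTables, aMul, aDiv, aMod, aPow, aOff]) : Env A s' :=
  h.congr (fun y hy => hr y (by rintro rfl; exact hi hy))
    fun y hy => ha y (by rintro rfl; exact haa hy)

theorem Env.eval_fst (h : Env A s) {p : ℕ} (hp : s.reg rPos = p)
    (hpn : p < A.card * A.card * A.card) : fstExpr.eval s = p % A.card := by
  simp [fstExpr, eval, hp, h.mod p (hpn.trans_le cube_le_arithLength)]

theorem Env.eval_snd (h : Env A s) {p : ℕ} (hp : s.reg rPos = p)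
    (hpn : p < A.card * A.card * A.card) : sndExpr.eval s = p / A.card % A.card := by
  have hL := hpn.trans_le cube_le_arithLength
  simp [sndExpr, eval, hp, h.div p hL, h.mod _ ((Nat.div_le_self _ _).trans_lt hL)]

theorem Env.eval_thd (h : Env A s) {p : ℕ} (hp : s.reg rPos = p)
    (hpn : p < A.card * A.card * A.card) : thdExpr.eval s = p / A.card / A.card := by
  have hL := hpn.trans_le cube_le_arithLength
  simp [thdExpr, eval, hp, h.div p hL, h.div _ ((Nat.div_le_self _ _).trans_lt hL)]

theorem Env.eval_mul (h : Env A s) {e : Expr} {x : ℕ} (he : e.eval s = x)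
    (hx : x < arithLength A) : (read aMul e).eval s = x * A.card := by
  simp [eval, he, h.mul x hx]

theorem mul_lt_mul_card {x m : ℕ} (hx : x < m) (hn : 0 < A.card) : x * A.card < m * A.card :=
  Nat.mul_lt_mul_of_pos_right hx hn

theorem Env.eval_index (h : Env A s) {e₁ e₂ e₃ : Expr} {x y z : ℕ} (h₁ : e₁.eval s = x)
    (h₂ : e₂.eval s = y) (h₃ : e₃.eval s = z) (hy : y < A.card) (hz : z < A.card) :
    (indexExpr e₁ e₂ e₃).eval s = x + y * A.card + z * A.card * A.card := by
  have hn : 0 < A.card := by omega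
  have hy' := hy.trans_le card_le_arithLength
  have hz' := hz.trans_le card_le_arithLength
  have := h.eval_mul (h.eval_mul h₃ hz') ((mul_lt_mul_card hz hn).trans_le sq_le_arithLength)
  simp only [indexExpr, Expr.eval] at this ⊢
  rw [this, h₁, h₂, h.mul y hy']

/-- The last of the three lookups has an argument x n² below n⁴; this accounts for the term n⁴ in
`arithLength`. -/
theorem Env.eval_base (h : Env A s) {e : Expr} {x : ℕ} (he : e.eval s = x)
    (hx : x < A.card * A.card) : (baseExpr e).eval s = x * A.card * A.card * A.card := by
  have hn : 0 < A.card := Nat.pos_of_ne_zero fun h => by simp [h] at hx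
  refine h.eval_mul (h.eval_mul (h.eval_mul he ?_) ?_) ?_
  · exact hx.trans_le sq_le_arithLength
  · exact (mul_lt_mul_card hx hn).trans_le cube_le_arithLength
  · exact (mul_lt_mul_card (mul_lt_mul_card hx hn) hn).trans_le fourth_le_arithLength

theorem pair_lt {n x y : ℕ} (hx : x < n) (hy : y < n) : x * n + y < n * n := by
  have := Nat.mul_le_mul_right n (Nat.succ_le_of_lt hx)
  rw [Nat.succ_mul] at this
  omega

theorem cube_le_loopBound : A.card * A.card * A.card ≤ loopBound A :=
  cube_le_arithLength.trans (Nat.le_succ _)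

theorem tabulate_spec {a : ℕ} {e : Expr} {R : State → Prop} (f : ℕ → ℕ) (hE : Env A s)
    (ha : a ∉ [aArity, aTables, aMul, aDiv, aMod, aPow, aOff])
    (he : ∀ p s₁, p < A.card * A.card * A.card → Env A s₁ → s₁.reg rPos = p →
      (∀ x ≠ rPos, s₁.reg x = s.reg x) → (∀ c ≠ a, s₁.arr c = s.arr c) → e.eval s₁ = f p)
    (hQ : ∀ s₁, Env A s₁ → (∀ x ≠ rPos, s₁.reg x = s.reg x) → (∀ c ≠ a, s₁.arr c = s.arr c) →
      (∀ p < A.card * A.card * A.card, s₁.arr a p = f p) → R s₁) :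
    wp (loopBound A) (tabulate a e) R s := by
  refine wp_fill (M := A.card * A.card * A.card) (B := 0) f cube_le_loopBound hE.cube hE.zero
    (by decide) (by decide) ?_ ?_
  · exact fun p s₁ hp hp₁ hr hc => he p s₁ hp (hE.fill hr hc (by decide) ha) hp₁ hr hc
  · intro s₁ hr hc h₁ _
    exact hQ s₁ (hE.fill hr hc (by decide) ha) hr hc fun p hp => by simpa using h₁ p hp

/-- Whenever `κ` is marked as present, the pool holds a table of a term operation whose values at
`P` and `Q` form the pair with code `κ`. -/
def Pool (A : FinAlgebra) (P Q : ℕ) (pres pool : ℕ → ℕ) : Prop :=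
  ∀ κ < A.card * A.card, pres κ ≠ 0 →
    A.TermTable (fun p => pool (κ * A.card * A.card * A.card + p)) ∧
    pool (κ * A.card * A.card * A.card + P) * A.card + pool (κ * A.card * A.card * A.card + Q) = κ

/-- Division by m recovers the block number. Hence storing one table in the pool does not disturb
the others. -/
theorem block_ne {m a b p q : ℕ} (h : a ≠ b) (hp : p < m) (hq : q < m) :
    a * m + p ≠ b * m + q := fun e => h <| by
  have hm : 0 < m := by omega
  have h₁ : (p + m * a) / m = a := by
    rw [Nat.add_mul_div_left _ _ hm, Nat.div_eq_of_lt hp, zero_add]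
  have h₂ : (q + m * b) / m = b := by
    rw [Nat.add_mul_div_left _ _ hm, Nat.div_eq_of_lt hq, zero_add]
  rw [← h₁, ← h₂, add_comm, mul_comm, e, add_comm, mul_comm]

/-- The key is computed from the table's own values at `P` and `Q`, so the pool invariant holds by
construction. Overwriting an earlier witness for the same pair does no harm. -/
theorem storeProg_spec (hE : Env A s) (hP : s.reg rPosA = P) (hQ : s.reg rPosB = Q)
    (hPn : P < A.card * A.card * A.card) (hQn : Q < A.card * A.card * A.card)
    (hpool : Pool A P Q (s.arr aPresent) (s.arr aPool)) (hT : A.TermTable (s.arr aScratch)) :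
    wp (loopBound A) storeProg (fun s' => Pool A P Q (s'.arr aPresent) (s'.arr aPool) ∧
      s'.arr aPresent = Function.update (s.arr aPresent)
        (s.arr aScratch P * A.card + s.arr aScratch Q) 1) s := by
  have hgP := hT.lt hPn
  have hgQ := hT.lt hQn
  have hκ := pair_lt hgP hgQ
  have hk : (add (read aMul (read aScratch (reg rPosA))) (read aScratch (reg rPosB))).eval s
      = s.arr aScratch P * A.card + s.arr aScratch Q := by
    simp [eval, hP, hQ, hE.mul _ (hgP.trans_le card_le_arithLength)]
  apply wp_seq
  apply wp_assign
  rw [hk]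
  generalize hκe : s.arr aScratch P * A.card + s.arr aScratch Q = κ at hκ ⊢
  apply wp_seq
  apply wp_assign
  rw [(hE.setReg (by decide)).eval_base (x := κ) (by simp [eval]) hκ]
  apply wp_seq
  refine wp_fill (M := A.card * A.card * A.card) (B := κ * A.card * A.card * A.card)
    (s.arr aScratch) cube_le_loopBound (by simp [hE.cube]) (by simp) (by decide) (by decide) ?_ ?_
  · intro j s₁ _ hj _ ha
    simp [eval, hj, ha aScratch (by decide)]
  · intro s₁ hr ha h₁ h₂
    have e₁ : s₁.reg rKey = κ := by simp [hr rKey (by decide)]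
    have e₂ : s₁.arr aPresent = s.arr aPresent := by simp [ha aPresent (by decide)]
    apply wp_write
    simp only [eval, e₁, e₂, State.setArr_arr, if_true]
    refine ⟨fun κ' hκ' hp => ?_, trivial⟩
    by_cases hκκ : κ' = κ
    · subst hκκ
      simp only [Nat.reduceEqDiff, if_false, h₁ P hPn, h₁ Q hQn]
      exact ⟨hT.congr fun p hp => h₁ p hp, hκe⟩
    · rw [Function.update_of_ne hκκ] at hp
      have same : ∀ p < A.card * A.card * A.card,
          s₁.arr aPool (κ' * A.card * A.card * A.card + p) =
            s.arr aPool (κ' * A.card * A.card * A.card + p) := fun p hp => by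
        refine (h₂ _ fun j hj => ?_).trans rfl
        simpa only [mul_assoc] using block_ne hκκ (by simpa only [mul_assoc] using hp)
          (by simpa only [mul_assoc] using hj)
      obtain ⟨h₃, h₄⟩ := hpool κ' hκ' hp
      simp only [Nat.reduceEqDiff, if_false, same P hPn, same Q hQn]
      exact ⟨h₃.congr same, h₄⟩

/-- Two positions u and v in a k-ary table encode a k-tuple of pairs, the j-th pair consisting of
their j-th digits. -/
theorem digitsProg_spec {k u v : ℕ} (hE : Env A s) (hk : s.reg rExp = k) (hkW : k ≤ loopBound A)
    (hn : 0 < A.card) (hu : s.reg rU = u) (hv : s.reg rV = v) (huL : u < arithLength A)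
    (hvL : v < arithLength A) :
    wp (loopBound A) digitsProg (fun s' =>
      (∀ j < k, s'.arr aDigit j =
        (u / A.card ^ j % A.card * A.card + v / A.card ^ j % A.card) *
          A.card * A.card * A.card) ∧
      (s'.reg rOk ≠ 0 ↔ ∀ j < k,
        s.arr aPresent (u / A.card ^ j % A.card * A.card + v / A.card ^ j % A.card) ≠ 0)) s := by
  apply wp_seq
  apply wp_assign
  apply wp_seq
  apply wp_assign
  apply wp_seq
  apply wp_assign
  refine wp_for (fun m s₁ => s₁.reg rRestU = u / A.card ^ m ∧ s₁.reg rRestV = v / A.card ^ m ∧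
      (∀ j < m, s₁.arr aDigit j =
        (u / A.card ^ j % A.card * A.card + v / A.card ^ j % A.card) *
          A.card * A.card * A.card) ∧
      (s₁.reg rOk ≠ 0 ↔ ∀ j < m,
        s.arr aPresent (u / A.card ^ j % A.card * A.card + v / A.card ^ j % A.card) ≠ 0))
    hkW (by simp [hk]) rfl rfl ?_ ?_ fun s₁ _ h => h.2.2
  · simp [eval, hu, hv]
  · rintro m s₁ hm hf hm₁ ⟨h₁, h₂, h₃, h₄⟩
    have hE₁ : Env A s₁ := (((hE.setReg (by decide)).setReg (by decide)).setReg (by decide)).frame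
      hf rfl
    have hp₁ : s₁.arr aPresent = s.arr aPresent := hf.arr aPresent rfl
    have huL' := (Nat.div_le_self u (A.card ^ m)).trans_lt huL
    have hvL' := (Nat.div_le_self v (A.card ^ m)).trans_lt hvL
    have hu' : u / A.card ^ m % A.card < A.card := Nat.mod_lt _ hn
    have hv' : v / A.card ^ m % A.card < A.card := Nat.mod_lt _ hn
    have hκ := pair_lt hu' hv'
    have hκe : (add (read aMul (read aMod (reg rRestU))) (read aMod (reg rRestV))).eval s₁ =
        u / A.card ^ m % A.card * A.card + v / A.card ^ m % A.card := by
      simp [eval, h₁, h₂, hE₁.mod _ huL', hE₁.mod _ hvL',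
        hE₁.mul _ (hu'.trans_le card_le_arithLength)]
    apply wp_seq
    apply wp_assign
    rw [hκe]
    generalize hκg : u / A.card ^ m % A.card * A.card + v / A.card ^ m % A.card = κ at hκ ⊢
    apply wp_seq
    apply wp_write
    rw [(hE₁.setReg (by decide)).eval_base (x := κ) (by simp [eval]) hκ]
    have d₁ : s₁.arr aDiv (u / A.card ^ m) = u / A.card ^ (m + 1) := by
      rw [hE₁.div _ huL', Nat.div_div_eq_div_mul, pow_succ]
    have d₂ : s₁.arr aDiv (v / A.card ^ m) = v / A.card ^ (m + 1) := by
      rw [hE₁.div _ hvL', Nat.div_div_eq_div_mul, pow_succ]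
    have dig : ∀ j < m + 1, Function.update (s₁.arr aDigit) m
        (κ * A.card * A.card * A.card) j =
        (u / A.card ^ j % A.card * A.card + v / A.card ^ j % A.card) *
          A.card * A.card * A.card := fun j hj => by
      rcases Nat.lt_succ_iff_lt_or_eq.1 hj with hj' | rfl
      · rw [Function.update_of_ne hj'.ne, h₃ j hj']
      · simp [hκg]
    have hall : (∀ j < m + 1, s.arr aPresent
        (u / A.card ^ j % A.card * A.card + v / A.card ^ j % A.card) ≠ 0) ↔
        s₁.reg rOk ≠ 0 ∧ s.arr aPresent κ ≠ 0 := by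
      rw [h₄, ← hκg, Nat.forall_lt_succ_right]
    apply wp_seq
    apply wp_ite
    · intro hp
      replace hp : s.arr aPresent κ ≠ 0 := by simpa [eval, hp₁] using hp
      apply wp_skip
      apply wp_seq
      apply wp_assign
      apply wp_assign
      simp only [hall]
      simpa [eval, h₁, h₂, d₁, d₂, hm₁, hp] using dig
    · intro hp
      replace hp : s.arr aPresent κ = 0 := by simpa [eval, hp₁] using hp
      apply wp_assign
      apply wp_seq
      apply wp_assign
      apply wp_assign
      simp only [hall]
      simpa [eval, h₁, h₂, d₁, d₂, hm₁, hp] using dig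

theorem applyProg_spec {i : Fin A.numOps} {g : ℕ → ℕ → ℕ} (hE : Env A s)
    (hk : s.reg rExp = A.arity i) (hkW : A.arity i ≤ loopBound A) (ho : s.reg rOff = A.offset i)
    (hn : 0 < A.card) (hg : ∀ j < A.arity i, ∀ p < A.card * A.card * A.card,
      s.arr aPool (s.arr aDigit j + p) = g j p ∧ g j p < A.card) :
    wp (loopBound A) applyProg (fun s' => ∀ p < A.card * A.card * A.card,
      ∃ d < A.card ^ A.arity i, (∀ j < A.arity i, d / A.card ^ j % A.card = g j p) ∧
        s'.arr aScratch p = A.opEntry i d) s := by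
  refine wp_for (fun m s₁ => ∀ p < m,
      ∃ d < A.card ^ A.arity i, (∀ j < A.arity i, d / A.card ^ j % A.card = g j p) ∧
        s₁.arr aScratch p = A.opEntry i d) cube_le_loopBound hE.cube rfl rfl (by simp) ?_
    fun s₁ _ h => h
  intro p s₁ hp hf hp₁ h₁
  have hE₁ := hE.frame hf rfl
  apply wp_seq
  apply wp_assign
  apply wp_seq
  -- Horner's scheme, most significant digit first: after m steps the digits of the index are the
  -- values of the last m arguments.
  refine wp_for (fun m s₂ => s₂.reg rIdx < A.card ^ m ∧
      ∀ j < m, s₂.reg rIdx / A.card ^ j % A.card = g (A.arity i - m + j) p) hkW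
    (by simp [hf.reg rExp rfl, hk]) rfl rfl (by simp [eval]) ?_ ?_
  · rintro m s₂ hm hf₂ hm₂ ⟨h₂, h₃⟩
    have hE₂ := (hE₁.setReg (by decide)).frame hf₂ rfl
    apply wp_assign
    have e₁ : s₂.reg rExp = A.arity i := by
      rw [hf₂.reg rExp rfl]; simp [hf.reg rExp rfl, hk]
    have e₂ : s₂.reg rPos = p := by rw [hf₂.reg rPos rfl]; simp [hp₁]
    have e₃ : s₂.arr aDigit = s.arr aDigit := by
      rw [hf₂.arr aDigit rfl]; simp [hf.arr aDigit rfl]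
    have e₄ : s₂.arr aPool = s.arr aPool := by
      rw [hf₂.arr aPool rfl]; simp [hf.arr aPool rfl]
    have hL : s₂.reg rIdx < arithLength A :=
      h₂.trans_le ((Nat.pow_le_pow_right hn hm.le).trans (pow_arity_le_arithLength i))
    obtain ⟨h₄, h₅⟩ := hg (A.arity i - 1 - m) (by omega) p hp
    simp only [eval, State.setReg_reg, e₁, e₂, e₃, e₄, hm₂, hE₂.mul _ hL, h₄]
    simp only [Nat.reduceEqDiff, if_true, if_false]
    refine ⟨?_, fun j hj => ?_⟩
    · have := Nat.mul_le_mul_right A.card (Nat.succ_le_of_lt h₂)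
      rw [Nat.succ_mul, ← pow_succ] at this
      omega
    · rw [mul_comm, show A.arity i - (m + 1) + j = A.arity i - 1 - m + j by omega]
      cases j with
      | zero => simp [Nat.mod_eq_of_lt h₅]
      | succ j =>
        rw [pow_succ', ← Nat.div_div_eq_div_mul, Nat.mul_add_div hn, Nat.div_eq_of_lt h₅, add_zero,
          h₃ j (by omega)]
        congr 1
        omega
  · rintro s₂ hf₂ ⟨h₂, h₃⟩
    apply wp_write
    have e₁ : s₂.reg rPos = p := by rw [hf₂.reg rPos rfl]; simp [hp₁]
    have e₂ : s₂.reg rOff = A.offset i := by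
      rw [hf₂.reg rOff rfl]; simp [hf.reg rOff rfl, ho]
    have e₃ : s₂.arr aScratch = s₁.arr aScratch := by rw [hf₂.arr aScratch rfl]; simp
    have hE₂ := (hE₁.setReg (by decide)).frame hf₂ rfl
    intro q hq
    rcases Nat.lt_succ_iff_lt_or_eq.1 hq with hq' | rfl
    · simpa [eval, e₁, e₃, Function.update_of_ne hq'.ne] using h₁ q hq'
    · refine ⟨s₂.reg rIdx, h₂, fun j hj => by simpa using h₃ j hj, ?_⟩
      simp [eval, e₁, e₂, hE₂.tables i _ h₂]

end RAM

/-! ### Correctness of the closure computation in A². -/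

namespace RAM

variable {W : ℕ} {s s' : State} {A : FinAlgebra} {P Q : ℕ}

theorem pair_inj {n x y x' y' : ℕ} (hy : y < n) (hy' : y' < n)
    (h : x * n + y = x' * n + y') : x = x' ∧ y = y' := by
  have hx : x = x' := by
    by_contra hne
    exact block_ne hne hy hy' h
  subst hx
  exact ⟨rfl, by omega⟩

theorem stepProg_spec {i : Fin A.numOps} {u v : ℕ} (hn : 2 ≤ A.card) (hE : Env A s)
    (hP : s.reg rPosA = P) (hQ : s.reg rPosB = Q)
    (hPn : P < A.card * A.card * A.card) (hQn : Q < A.card * A.card * A.card)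
    (hpool : Pool A P Q (s.arr aPresent) (s.arr aPool)) (hk : s.reg rExp = A.arity i)
    (ho : s.reg rOff = A.offset i) (hu : s.reg rU = u) (hv : s.reg rV = v)
    (hun : u < A.card ^ A.arity i) (hvn : v < A.card ^ A.arity i) :
    wp (loopBound A) stepProg (fun s' => Pool A P Q (s'.arr aPresent) (s'.arr aPool) ∧
      (∀ κ, s.arr aPresent κ ≠ 0 → s'.arr aPresent κ ≠ 0) ∧
      ((∀ j < A.arity i,
        s.arr aPresent (u / A.card ^ j % A.card * A.card + v / A.card ^ j % A.card) ≠ 0) →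
        s'.arr aPresent (A.opEntry i u * A.card + A.opEntry i v) ≠ 0)) s := by
  have hn0 : 0 < A.card := by omega
  have hkW : A.arity i ≤ loopBound A :=
    (arity_le_size hn i).trans ((Nat.le_add_left _ _).trans (Nat.le_succ _))
  have digit_lt : ∀ x j : ℕ, x / A.card ^ j % A.card < A.card := fun x j => Nat.mod_lt _ hn0
  apply wp_seq
  refine (digitsProg_spec hE hk hkW hn0 hu hv (hun.trans_le (pow_arity_le_arithLength i))
    (hvn.trans_le (pow_arity_le_arithLength i))).mono fun s₁ hf₁ ⟨h₁, h₂⟩ => ?_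
  have hE₁ := hE.frame hf₁ rfl
  have e₁ : s₁.arr aPresent = s.arr aPresent := hf₁.arr _ rfl
  have e₂ : s₁.arr aPool = s.arr aPool := hf₁.arr _ rfl
  apply wp_ite
  · intro hok
    have hall := h₂.1 hok
    have hmem := fun j (hj : j < A.arity i) =>
      hpool _ (pair_lt (digit_lt u j) (digit_lt v j)) (hall j hj)
    apply wp_seq
    refine (applyProg_spec (i := i) (g := fun j p => s.arr aPool
      ((u / A.card ^ j % A.card * A.card + v / A.card ^ j % A.card) *
          A.card * A.card * A.card + p)) hE₁ ((hf₁.reg _ rfl).trans hk) hkW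
      ((hf₁.reg _ rfl).trans ho) hn0 fun j hj p hp => ⟨by rw [e₂, h₁ j hj],
        (hmem j hj).1.lt hp⟩).mono fun s₂ hf₂ h₃ => ?_
    choose! d hd₁ hd₂ hd₃ using h₃
    have hT : A.TermTable (s₂.arr aScratch) :=
      (FinAlgebra.termTable_op i (fun j hj => (hmem j hj).1)
        fun p hp => ⟨hd₁ p hp, hd₂ p hp⟩).congr hd₃
    -- By the pool invariant the j-th table takes the j-th digit of u at `P` and that of v at `Q`.
    -- So the positions looked up there are u and v themselves, and the new key is the intended
    -- pair.
    have hval := fun j (hj : j < A.arity i) =>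
      pair_inj ((hmem j hj).1.lt hQn) (digit_lt v j) (hmem j hj).2
    have hdP : d P = u := eq_of_digits_eq (hd₁ P hPn) hun fun j hj =>
      (hd₂ P hPn j hj).trans (hval j hj).1
    have hdQ : d Q = v := eq_of_digits_eq (hd₁ Q hQn) hvn fun j hj =>
      (hd₂ Q hQn j hj).trans (hval j hj).2
    have e₃ : s₂.arr aPresent = s.arr aPresent := (hf₂.arr _ rfl).trans e₁
    have e₄ : s₂.arr aPool = s.arr aPool := (hf₂.arr _ rfl).trans e₂
    refine (storeProg_spec (hE₁.frame hf₂ rfl)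
      (((hf₂.reg _ rfl).trans (hf₁.reg _ rfl)).trans hP)
      (((hf₂.reg _ rfl).trans (hf₁.reg _ rfl)).trans hQ) hPn hQn (by rwa [e₃, e₄])
      hT).mono fun s₃ _ ⟨h₄, h₅⟩ => ⟨h₄, fun κ hκ => ?_, fun _ => ?_⟩
    · rw [h₅, e₃, Function.update_apply]
      split_ifs <;> simp [hκ]
    · rw [h₅, hd₃ P hPn, hd₃ Q hQn, hdP, hdQ]
      simp
  · intro hok
    apply wp_skip
    rw [e₁, e₂]
    exact ⟨hpool, fun _ h => h, fun h => absurd hok (h₂.2 h)⟩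

/-- One round keeps the pool and adds all results of basic operations to it. -/
theorem roundProg_spec (hn : 2 ≤ A.card) (hE : Env A s) (hP : s.reg rPosA = P)
    (hQ : s.reg rPosB = Q) (hPn : P < A.card * A.card * A.card)
    (hQn : Q < A.card * A.card * A.card)
    (hpool : Pool A P Q (s.arr aPresent) (s.arr aPool)) :
    wp (loopBound A) roundProg (fun s' => Pool A P Q (s'.arr aPresent) (s'.arr aPool) ∧
      (∀ κ, s.arr aPresent κ ≠ 0 → s'.arr aPresent κ ≠ 0) ∧
      ∀ (i : Fin A.numOps) (u v : ℕ), u < A.card ^ A.arity i → v < A.card ^ A.arity i →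
      (∀ j < A.arity i,
        s.arr aPresent (u / A.card ^ j % A.card * A.card + v / A.card ^ j % A.card) ≠ 0) →
        s'.arr aPresent (A.opEntry i u * A.card + A.opEntry i v) ≠ 0) s := by
  have hpW := fun i => (pow_arity_le_arithLength (A := A) i).trans (Nat.le_succ _)
  have hoW : A.numOps ≤ loopBound A :=
    (numOps_le_size hn).trans ((Nat.le_add_left _ _).trans (Nat.le_succ _))
  let done (i : Fin A.numOps) (u v : ℕ) (s' : State) : Prop :=
    (∀ j < A.arity i,
        s.arr aPresent (u / A.card ^ j % A.card * A.card + v / A.card ^ j % A.card) ≠ 0) →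
        s'.arr aPresent (A.opEntry i u * A.card + A.opEntry i v) ≠ 0
  refine wp_for (fun m s' => Pool A P Q (s'.arr aPresent) (s'.arr aPool) ∧
      (∀ κ, s.arr aPresent κ ≠ 0 → s'.arr aPresent κ ≠ 0) ∧
      ∀ (i : Fin A.numOps), (i : ℕ) < m → ∀ u v : ℕ, u < A.card ^ A.arity i →
        v < A.card ^ A.arity i → done i u v s') hoW hE.numOps rfl rfl
    ⟨hpool, fun _ h => h, fun _ h => absurd h (Nat.not_lt_zero _)⟩ ?_
    fun s₁ _ ⟨h₁, h₂, h₃⟩ => ⟨h₁, h₂, fun i => h₃ i i.2⟩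
  rintro m s₁ hm hf₁ hm₁ ⟨h₁, h₂, h₃⟩
  have hE₁ := hE.frame hf₁ rfl
  obtain ⟨i, rfl⟩ : ∃ i : Fin A.numOps, (i : ℕ) = m := ⟨⟨m, hm⟩, rfl⟩
  apply wp_seq
  apply wp_assign
  apply wp_seq
  apply wp_assign
  apply wp_seq
  apply wp_assign
  simp only [eval, State.setReg_reg, State.setReg_arr, Nat.reduceEqDiff, if_false, hm₁,
    hE₁.arity i, hE₁.pow i, hE₁.off i]
  have hE₂ : Env A (((s₁.setReg rExp (A.arity i)).setReg rPow (A.card ^ A.arity i)).setReg rOff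
      (A.offset i)) := ((hE₁.setReg (by decide)).setReg (by decide)).setReg (by decide)
  refine wp_for (fun u s' => Pool A P Q (s'.arr aPresent) (s'.arr aPool) ∧
      (∀ κ, s₁.arr aPresent κ ≠ 0 → s'.arr aPresent κ ≠ 0) ∧
      ∀ u' < u, ∀ v < A.card ^ A.arity i, done i u' v s') (hpW i) (by simp) rfl rfl
    ⟨h₁, fun _ h => h, fun _ h => absurd h (Nat.not_lt_zero _)⟩ ?_ ?_
  · rintro u s₂ hu hf₂ hu₂ ⟨h₄, h₅, h₆⟩
    refine wp_for (fun v s' => Pool A P Q (s'.arr aPresent) (s'.arr aPool) ∧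
      (∀ κ, s₂.arr aPresent κ ≠ 0 → s'.arr aPresent κ ≠ 0) ∧
      ∀ v' < v, done i u v' s') (hpW i) (by rw [hf₂.reg rPow rfl]; simp) rfl rfl
      ⟨h₄, fun _ h => h, fun _ h => absurd h (Nat.not_lt_zero _)⟩ ?_ ?_
    · rintro v s₃ hv hf₃ hv₃ ⟨h₇, h₈, h₉⟩
      refine (stepProg_spec (i := i) (u := u) (v := v) hn ((hE₂.frame hf₂ rfl).frame hf₃ rfl)
        ?_ ?_ hPn hQn h₇ ?_ ?_ ?_ hv₃ hu hv).mono fun s₄ _ ⟨h₁₀, h₁₁, h₁₂⟩ =>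
          ⟨h₁₀, fun κ hκ => h₁₁ κ (h₈ κ hκ), fun v' hv' => ?_⟩
      · rw [hf₃.reg _ rfl, hf₂.reg _ rfl]; simp [hf₁.reg rPosA rfl, hP]
      · rw [hf₃.reg _ rfl, hf₂.reg _ rfl]; simp [hf₁.reg rPosB rfl, hQ]
      · rw [hf₃.reg _ rfl, hf₂.reg _ rfl]; simp
      · rw [hf₃.reg _ rfl, hf₂.reg _ rfl]; simp
      · rw [hf₃.reg _ rfl]; simp [hu₂]
      · rcases Nat.lt_succ_iff_lt_or_eq.1 hv' with hv'' | rfl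
        · exact fun h => h₁₁ _ (h₉ v' hv'' h)
        -- The premise concerns the start of the round; marks are never removed, so it still holds
        -- in the current state.
        · exact fun h => h₁₂ fun j hj => h₈ _ (h₅ _ (h₂ _ (h j hj)))
    · rintro s₃ - ⟨h₇, h₈, h₉⟩
      refine ⟨h₇, fun κ hκ => h₈ κ (h₅ κ hκ), fun u' hu' v hv => ?_⟩
      rcases Nat.lt_succ_iff_lt_or_eq.1 hu' with hu'' | rfl
      · exact fun h => h₈ _ (h₆ u' hu'' v hv h)
      · exact h₉ v hv
  · rintro s₂ - ⟨h₄, h₅, h₆⟩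
    refine ⟨h₄, fun κ hκ => h₅ κ (h₂ κ hκ), fun i' hi' u v hu hv => ?_⟩
    rcases Nat.lt_succ_iff_lt_or_eq.1 hi' with hi'' | hi''
    · exact fun h => h₅ _ (h₃ i' hi'' u v hu hv h)
    · obtain rfl := Fin.ext hi''
      exact h₆ u hu v hv

/-- The pool contains a table for every pair of values of a term operation. -/
theorem searchProg_spec (hn : 2 ≤ A.card) (hE : Env A s) (hP : s.reg rPosA = P)
    (hQ : s.reg rPosB = Q) (hPn : P < A.card * A.card * A.card)
    (hQn : Q < A.card * A.card * A.card) :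
    wp (loopBound A) searchProg (fun s' => Pool A P Q (s'.arr aPresent) (s'.arr aPool) ∧
      ∀ g, A.TermTable g → s'.arr aPresent (g P * A.card + g Q) ≠ 0) s := by
  have hsW : A.card * A.card ≤ loopBound A := sq_le_arithLength.trans (Nat.le_succ _)
  apply wp_seq
  -- Clearing the marks suffices: leftover pool entries of an earlier search carry no claim without
  -- a mark.
  refine wp_fill (M := A.card * A.card) (B := 0) (fun _ => 0) hsW hE.sq hE.zero (by decide)
    (by decide) (fun _ _ _ _ _ _ => rfl) fun s₁ hr₁ ha₁ h₁ _ => ?_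
  have hE₁ := hE.fill hr₁ ha₁ (by decide) (by decide)
  have hpool₁ : Pool A P Q (s₁.arr aPresent) (s₁.arr aPool) := fun κ hκ hp =>
    absurd (by simpa using h₁ κ hκ) hp
  apply wp_seq
  refine tabulate_spec (fun p => p % A.card) hE₁ (by decide)
    (fun p t hp hEt hpt _ _ => hEt.eval_fst hpt hp) fun s₂ hE₂ hr₂ ha₂ h₂ => ?_
  apply wp_seq
  refine (storeProg_spec (P := P) (Q := Q) hE₂
    (by rw [hr₂ _ (by decide), hr₁ _ (by decide), hP])
    (by rw [hr₂ _ (by decide), hr₁ _ (by decide), hQ]) hPn hQn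
    (by rwa [ha₂ _ (by decide), ha₂ _ (by decide)])
    (FinAlgebra.termTable_fst.congr h₂)).mono fun s₃ hf₃ ⟨hpool₃, h₃⟩ => ?_
  apply wp_seq
  refine tabulate_spec (fun p => p / A.card % A.card) (hE₂.frame hf₃ rfl) (by decide)
    (fun p t hp hEt hpt _ _ => hEt.eval_snd hpt hp) fun s₄ hE₄ hr₄ ha₄ h₄ => ?_
  apply wp_seq
  refine (storeProg_spec (P := P) (Q := Q) hE₄
    (by rw [hr₄ _ (by decide), hf₃.reg _ rfl, hr₂ _ (by decide), hr₁ _ (by decide), hP])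
    (by rw [hr₄ _ (by decide), hf₃.reg _ rfl, hr₂ _ (by decide), hr₁ _ (by decide), hQ]) hPn hQn
    (by rwa [ha₄ _ (by decide), ha₄ _ (by decide)])
    (FinAlgebra.termTable_snd.congr h₄)).mono fun s₅ hf₅ ⟨hpool₅, h₅⟩ => ?_
  apply wp_seq
  refine tabulate_spec (fun p => p / A.card / A.card) (hE₄.frame hf₅ rfl) (by decide)
    (fun p t hp hEt hpt _ _ => hEt.eval_thd hpt hp) fun s₆ hE₆ hr₆ ha₆ h₆ => ?_
  apply wp_seq
  have hP₆ : s₆.reg rPosA = P := by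
    rw [hr₆ _ (by decide), hf₅.reg _ rfl, hr₄ _ (by decide), hf₃.reg _ rfl, hr₂ _ (by decide),
      hr₁ _ (by decide), hP]
  have hQ₆ : s₆.reg rPosB = Q := by
    rw [hr₆ _ (by decide), hf₅.reg _ rfl, hr₄ _ (by decide), hf₃.reg _ rfl, hr₂ _ (by decide),
      hr₁ _ (by decide), hQ]
  refine (storeProg_spec (P := P) (Q := Q) hE₆ hP₆ hQ₆ hPn hQn
    (by rwa [ha₆ _ (by decide), ha₆ _ (by decide)])
    (FinAlgebra.termTable_thd.congr h₆)).mono fun s₇ hf₇ ⟨hpool₇, h₇⟩ => ?_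
  rw [h₆ P hPn, h₆ Q hQn, ha₆ _ (by decide), h₅, h₄ P hPn, h₄ Q hQn, ha₄ _ (by decide), h₃,
    h₂ P hPn, h₂ Q hQn] at h₇
  have hE₇ := hE₆.frame hf₇ rfl
  apply wp_seq
  apply wp_assign
  let projections (pres : ℕ → ℕ) : Prop :=
    pres (P % A.card * A.card + Q % A.card) ≠ 0 ∧
    pres (P / A.card % A.card * A.card + Q / A.card % A.card) ≠ 0 ∧
    pres (P / A.card / A.card * A.card + Q / A.card / A.card) ≠ 0
  let count (pres : ℕ → ℕ) : ℕ :=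
    ((Finset.range (A.card * A.card)).filter fun κ => pres κ ≠ 0).card
  -- After r rounds the search is complete or at least r pairs are marked. With n² + 1 rounds the
  -- second alternative is impossible.
  refine wp_for (M := A.card * A.card + 1) (fun r s' =>
      Pool A P Q (s'.arr aPresent) (s'.arr aPool) ∧ projections (s'.arr aPresent) ∧
      ((∀ g, A.TermTable g → s'.arr aPresent (g P * A.card + g Q) ≠ 0) ∨
        r ≤ count (s'.arr aPresent))) (Nat.succ_le_succ sq_le_arithLength)
    (by simp [eval, hE₇.sq]) rfl rfl ⟨hpool₇, ?_, .inr (Nat.zero_le _)⟩ ?_ ?_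
  · simp only [projections, State.setReg_arr, h₇, Function.update_apply]
    refine ⟨?_, ?_, ?_⟩ <;> split_ifs <;> simp
  · rintro r s₈ hr hf₈ - ⟨hpool₈, ⟨p₁, p₂, p₃⟩, h₈⟩
    refine (roundProg_spec hn ((hE₇.setReg (by decide)).frame hf₈ rfl) ?_ ?_ hPn hQn
      hpool₈).mono fun s₉ _ ⟨hpool₉, hmono, hclosed⟩ =>
        ⟨hpool₉, ⟨hmono _ p₁, hmono _ p₂, hmono _ p₃⟩, ?_⟩
    · rw [hf₈.reg _ rfl]; simp [hf₇.reg rPosA rfl, hP₆]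
    · rw [hf₈.reg _ rfl]; simp [hf₇.reg rPosB rfl, hQ₆]
    rcases h₈ with h₈ | h₈
    · exact .inl fun g hg => hmono _ (h₈ g hg)
    -- A round without a new pair shows that the marked set was already a subalgebra; otherwise the
    -- count grows strictly.
    by_cases hsub : ∀ κ < A.card * A.card, s₉.arr aPresent κ ≠ 0 → s₈.arr aPresent κ ≠ 0
    · refine .inl fun g hg => hmono _ ?_
      refine hg.key_mem (S := fun κ => s₈.arr aPresent κ ≠ 0) hPn hQn p₁ p₂ p₃
        fun i u v hu hv hj => hsub _ ?_ (hclosed i u v hu hv hj)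
      exact pair_lt (FinAlgebra.opEntry_lt hu) (FinAlgebra.opEntry_lt hv)
    · push Not at hsub
      obtain ⟨κ, hκ, h₉, h₁₀⟩ := hsub
      refine .inr (Nat.succ_le_of_lt (h₈.trans_lt (Finset.card_lt_card ?_)))
      refine Finset.ssubset_iff_of_subset (fun κ' hκ' => ?_) |>.2 ⟨κ, ?_, ?_⟩
      · rw [Finset.mem_filter] at hκ' ⊢
        exact ⟨hκ'.1, hmono _ hκ'.2⟩
      · exact Finset.mem_filter.2 ⟨Finset.mem_range.2 hκ, h₉⟩
      · simp [h₁₀]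
  · rintro s₈ - ⟨hpool₈, -, h₈ | h₈⟩
    · exact ⟨hpool₈, h₈⟩
    · have : count (s₈.arr aPresent) ≤ A.card * A.card :=
        (Finset.card_filter_le _ _).trans (by simp)
      omega

end RAM

namespace RAM

/-! ## Composing local Maltsev terms -/

/-- Given elements `a` and `u` in `rA` and `rTabb`, improves the term operation in `aSide` so that
it satisfies `g (c, c, d) = d` for the pair `(c, d)` with code `rInner` as well. -/
def innerProg : Prog :=
  assign rC (read aMod (reg rInner)) ⨟
  assign rD (read aDiv (reg rInner)) ⨟
  assign rSccd (read aSide (indexExpr (reg rC) (reg rC) (reg rD))) ⨟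
  assign rPosA (indexExpr (reg rA) (reg rTabb) (reg rTabb)) ⨟
  assign rPosB (indexExpr (reg rSccd) (reg rSccd) (reg rD)) ⨟
  searchProg ⨟
  assign rKey (add (read aMul (reg rA)) (reg rD)) ⨟
  assign rBase (baseExpr (reg rKey)) ⨟
  ite (read aPresent (reg rKey))
    (tabulate aScratch (read aPool (add (reg rBase)
        (indexExpr (read aSide (reg rPos))
          (read aSide (indexExpr sndExpr sndExpr thdExpr)) thdExpr))) ⨟
      tabulate aSide (read aScratch (reg rPos)))
    (assign rFail (const 1))

/-- Improves the term operation in `aMain` so that it satisfies `g (a, b, b) = a` for the pair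
`(a, b)` with code `rOuter` as well. -/
def outerProg : Prog :=
  assign rA (read aMod (reg rOuter)) ⨟
  assign rB (read aDiv (reg rOuter)) ⨟
  assign rTabb (read aMain (indexExpr (reg rA) (reg rB) (reg rB))) ⨟
  tabulate aSide fstExpr ⨟
  for_ rInner rSq innerProg ⨟
  tabulate aScratch (read aSide (indexExpr fstExpr
      (read aMain (indexExpr fstExpr sndExpr sndExpr)) (read aMain (reg rPos)))) ⨟
  tabulate aMain (read aScratch (reg rPos))

/-- Computes a Maltsev term operation after the precomputation. -/
def maltsevProg : Prog :=
  tabulate aMain thdExpr ⨟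
  for_ rOuter rSq outerProg ⨟
  assign rCard (sub (const 1) (reg rFail))

/-- The whole algorithm. -/
def mainProg : Prog :=
  ite (sub (reg rCard) (const 1)) (setupProg ⨟ maltsevProg) (assign rCard (const 1))

/-! ### Correctness of the composition of local Maltsev terms. -/

variable {s s' : State} {A : FinAlgebra}

open FinAlgebra

/-- Evaluating r(k(x,y,z), k(y,y,z), z) at (a,u,u), at the new triple (c,c,d) and at the old ones
gives the three identities. If no r is found, k is left alone and the flag certifies that no Maltsev
term exists. -/
theorem innerProg_spec {a u q : ℕ} (hA : A.IsIdempotent) (hn : 2 ≤ A.card) (hE : Env A s)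
    (ha : s.reg rA = a) (hu : s.reg rTabb = u) (hq : s.reg rInner = q) (han : a < A.card)
    (hun : u < A.card) (hqn : q < A.card * A.card) (hT : A.TermTable (s.arr aSide)) :
    wp (loopBound A) innerProg (fun s' => A.TermTable (s'.arr aSide) ∧
      (s'.reg rFail ≠ 0 → s.reg rFail ≠ 0 ∨ ¬ ∃ g, A.MaltsevTable g) ∧
      (s'.reg rFail = 0 → s.reg rFail = 0 ∧
        (s.arr aSide (a + u * A.card + u * A.card * A.card) = a →
          s'.arr aSide (a + u * A.card + u * A.card * A.card) = a) ∧
        s'.arr aSide (q % A.card + q % A.card * A.card + q / A.card * A.card * A.card)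
          = q / A.card ∧
        ∀ c < A.card, ∀ d < A.card,
          s.arr aSide (c + c * A.card + d * A.card * A.card) = d →
          s'.arr aSide (c + c * A.card + d * A.card * A.card) = d)) s := by
  have hn0 : 0 < A.card := by omega
  have hqL := hqn.trans_le (sq_le_arithLength (A := A))
  have hc : q % A.card < A.card := Nat.mod_lt _ hn0
  have hd : q / A.card < A.card := Nat.div_lt_of_lt_mul hqn
  have ec : (read aMod (reg rInner)).eval s = q % A.card := by simp [eval, hq, hE.mod q hqL]
  apply wp_seq
  apply wp_assign
  rw [ec]
  generalize q % A.card = c at hc ⊢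
  set s₁ := s.setReg rC c with hs₁
  have hE₁ : Env A s₁ := hE.setReg (by decide)
  have ed : (read aDiv (reg rInner)).eval s₁ = q / A.card := by
    simp [hs₁, eval, hq, hE.div q hqL]
  apply wp_seq
  apply wp_assign
  rw [ed]
  generalize q / A.card = d at hd ⊢
  set s₂ := s₁.setReg rD d with hs₂
  have hE₂ : Env A s₂ := hE₁.setReg (by decide)
  have ew : (read aSide (indexExpr (reg rC) (reg rC) (reg rD))).eval s₂ =
      s.arr aSide (c + c * A.card + d * A.card * A.card) := by
    rw [eval, hE₂.eval_index (x := c) (y := c) (z := d) (by simp [hs₁, hs₂, eval])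
      (by simp [hs₁, hs₂, eval]) (by simp [hs₂, eval]) hc hd]
    rfl
  apply wp_seq
  apply wp_assign
  rw [ew]
  have hw := hT.lt (index_lt hc hc hd)
  generalize hwe : s.arr aSide (c + c * A.card + d * A.card * A.card) = w at hw ⊢
  set s₃ := s₂.setReg rSccd w with hs₃
  have hE₃ : Env A s₃ := hE₂.setReg (by decide)
  apply wp_seq
  apply wp_assign
  rw [hE₃.eval_index (x := a) (y := u) (z := u) (by simp [hs₁, hs₂, hs₃, eval, ha])
    (by simp [hs₁, hs₂, hs₃, eval, hu]) (by simp [hs₁, hs₂, hs₃, eval, hu]) hun hun]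
  have hPn := index_lt han hun hun
  set P := a + u * A.card + u * A.card * A.card with hP
  set s₄ := s₃.setReg rPosA P with hs₄
  have hE₄ : Env A s₄ := hE₃.setReg (by decide)
  apply wp_seq
  apply wp_assign
  rw [hE₄.eval_index (x := w) (y := w) (z := d) (by simp [hs₃, hs₄, eval])
    (by simp [hs₃, hs₄, eval]) (by simp [hs₂, hs₃, hs₄, eval]) hw hd]
  have hQn := index_lt hw hw hd
  set Q := w + w * A.card + d * A.card * A.card with hQ
  set s₅ := s₄.setReg rPosB Q with hs₅
  have hE₅ : Env A s₅ := hE₄.setReg (by decide)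
  apply wp_seq
  refine (searchProg_spec (P := P) (Q := Q) hn hE₅ (by simp [hs₄, hs₅]) (by simp [hs₅]) hPn
    hQn).mono fun s₆ hf₆ ⟨hpool, hall⟩ => ?_
  have hE₆ := hE₅.frame hf₆ rfl
  have hside₆ : s₆.arr aSide = s.arr aSide := hf₆.arr _ rfl
  have hfail₆ : s₆.reg rFail = s.reg rFail := by
    rw [hf₆.reg _ rfl]; simp [hs₁, hs₂, hs₃, hs₄, hs₅]
  have ek : (add (read aMul (reg rA)) (reg rD)).eval s₆ = a * A.card + d := by
    have e₁ : s₆.reg rA = a := by rw [hf₆.reg _ rfl]; simp [hs₁, hs₂, hs₃, hs₄, hs₅, ha]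
    have e₂ : s₆.reg rD = d := by rw [hf₆.reg _ rfl]; simp [hs₂, hs₃, hs₄, hs₅]
    simp [eval, e₁, e₂, hE₆.mul a (han.trans_le card_le_arithLength)]
  have hκ := pair_lt han hd
  apply wp_seq
  apply wp_assign
  rw [ek]
  generalize hκe : a * A.card + d = κ at hκ ⊢
  apply wp_seq
  apply wp_assign
  rw [(hE₆.setReg (by decide)).eval_base (x := κ) (by simp [eval]) hκ]
  set s₇ := (s₆.setReg rKey κ).setReg rBase (κ * A.card * A.card * A.card) with hs₇
  have hE₇ : Env A s₇ := (hE₆.setReg (by decide)).setReg (by decide)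
  have hside₇ : s₇.arr aSide = s.arr aSide := hside₆
  have hfail₇ : s₇.reg rFail = s.reg rFail := by simp [hs₇, hfail₆]
  apply wp_ite
  · intro hpres
    replace hpres : s₆.arr aPresent κ ≠ 0 := by simpa [hs₇, eval] using hpres
    obtain ⟨hr, hrκ⟩ := hpool κ hκ hpres
    rw [← hκe] at hrκ
    -- Decoding the key: r(a,u,u) = a and r(w,w,d) = d.
    obtain ⟨hrP, hrQ⟩ := pair_inj (hκe ▸ hr.lt hQn) hd hrκ
    rw [hκe] at hrP hrQ
    have hg' := hr.comp hT (hT.comp termTable_snd termTable_snd termTable_thd) termTable_thd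
    have hri := fun {x : ℕ} (hx : x < A.card) => hr.idem hA hx
    generalize hg : s.arr aSide = g at *
    apply wp_seq
    refine tabulate_spec (fun p => s₆.arr aPool (κ * A.card * A.card * A.card +
      (g p + g (p / A.card % A.card + p / A.card % A.card * A.card +
        p / A.card / A.card * A.card * A.card) * A.card + p / A.card / A.card * A.card * A.card)))
      hE₇ (by decide) ?_ ?_
    · intro p t hp hEt hpt hrt hat
      have ht : t.arr aSide = g := (hat _ (by decide)).trans hside₇
      have ht' : t.arr aPool = s₆.arr aPool := hat _ (by decide)
      have ht'' : t.reg rBase = κ * A.card * A.card * A.card :=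
        (hrt _ (by decide)).trans (by simp [hs₇])
      have hx₁ : p / A.card % A.card < A.card := Nat.mod_lt _ hn0
      have hx₂ := div_div_lt hp
      have e₁ : (read aSide (indexExpr sndExpr sndExpr thdExpr)).eval t =
          g (p / A.card % A.card + p / A.card % A.card * A.card +
            p / A.card / A.card * A.card * A.card) := by
        rw [eval, hEt.eval_index (hEt.eval_snd hpt hp) (hEt.eval_snd hpt hp) (hEt.eval_thd hpt hp)
          hx₁ hx₂, ht]
      have e₂ : (read aSide (reg rPos)).eval t = g p := by simp [eval, hpt, ht]
      rw [eval, eval, hEt.eval_index e₂ e₁ (hEt.eval_thd hpt hp)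
        (hT.lt (index_lt hx₁ hx₁ hx₂)) hx₂, ht', eval, ht'']
    intro s₈ hE₈ hr₈ ha₈ h₈
    refine tabulate_spec (s₈.arr aScratch) hE₈ (by decide) ?_ ?_
    · intro p t _ _ hpt _ hat
      simp [eval, hpt, hat aScratch (by decide)]
    intro s₉ hE₉ hr₉ ha₉ h₉
    have hfail₉ : s₉.reg rFail = s.reg rFail := by
      rw [hr₉ _ (by decide), hr₈ _ (by decide), hfail₇]
    have hval : ∀ x y z, x < A.card → y < A.card → z < A.card →
        s₉.arr aSide (x + y * A.card + z * A.card * A.card) =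
        s₆.arr aPool (κ * A.card * A.card * A.card +
          (g (x + y * A.card + z * A.card * A.card) +
            g (y + y * A.card + z * A.card * A.card) * A.card + z * A.card * A.card)) := by
      intro x y z hx hy hz
      rw [h₉ _ (index_lt hx hy hz), h₈ _ (index_lt hx hy hz), index_div_mod hx hy,
        index_div_div hx hy]
    refine ⟨hg'.congr fun p hp => by rw [h₉ p hp, h₈ p hp], fun h => .inl (hfail₉ ▸ h),
      fun h => ⟨hfail₉ ▸ h, fun h₁₀ => ?_, ?_, fun c' hc' d' hd' h₁₀ => ?_⟩⟩
    · rw [hP, hval a u u han hun hun, ← hP, h₁₀, hT.idem hA hun, ← hP, hrP]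
    · rw [hval c c d hc hc hd, hwe, ← hQ, hrQ]
    · rw [hval c' c' d' hc' hc' hd', h₁₀, hri hd']
  · intro hpres
    replace hpres : s₆.arr aPresent κ = 0 := by simpa [hs₇, eval] using hpres
    apply wp_assign
    refine ⟨hside₇ ▸ hT, fun _ => .inr ?_, fun h => ?_⟩
    · rintro ⟨g, hg⟩
      -- A Maltsev table has the values a at `P` and d at `Q`, so the complete search would have
      -- marked this key.
      refine hall g hg.term ?_
      rwa [hP, hQ, hg.left u hun a han, hg.right w hw d hd, hκe]
    · simp [eval] at h

/-- The identities are only claimed while the flag is 0. After a failure the run continues, and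
being a term table still has to be maintained, as it keeps all values below n and all lookups in
range. -/
theorem outerProg_spec {q : ℕ} (hA : A.IsIdempotent) (hn : 2 ≤ A.card) (hE : Env A s)
    (hq : s.reg rOuter = q) (hqn : q < A.card * A.card) (hT : A.TermTable (s.arr aMain))
    (hright : s.reg rFail = 0 → ∀ c < A.card, ∀ d < A.card,
      s.arr aMain (c + c * A.card + d * A.card * A.card) = d) :
    wp (loopBound A) outerProg (fun s' => A.TermTable (s'.arr aMain) ∧
      (s'.reg rFail ≠ 0 → s.reg rFail ≠ 0 ∨ ¬ ∃ g, A.MaltsevTable g) ∧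
      (s'.reg rFail = 0 → s.reg rFail = 0 ∧
        (∀ c < A.card, ∀ d < A.card,
          s'.arr aMain (c + c * A.card + d * A.card * A.card) = d) ∧
        s'.arr aMain (q % A.card + q / A.card * A.card + q / A.card * A.card * A.card)
          = q % A.card ∧
        ∀ a < A.card, ∀ b < A.card,
          s.arr aMain (a + b * A.card + b * A.card * A.card) = a →
          s'.arr aMain (a + b * A.card + b * A.card * A.card) = a)) s := by
  have hn0 : 0 < A.card := by omega
  have hqL := hqn.trans_le (sq_le_arithLength (A := A))
  have ha : q % A.card < A.card := Nat.mod_lt _ hn0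
  have hb : q / A.card < A.card := Nat.div_lt_of_lt_mul hqn
  have ea : (read aMod (reg rOuter)).eval s = q % A.card := by simp [eval, hq, hE.mod q hqL]
  apply wp_seq
  apply wp_assign
  rw [ea]
  generalize q % A.card = a at ha ⊢
  set s₁ := s.setReg rA a with hs₁
  have hE₁ : Env A s₁ := hE.setReg (by decide)
  have eb : (read aDiv (reg rOuter)).eval s₁ = q / A.card := by
    simp [hs₁, eval, hq, hE.div q hqL]
  apply wp_seq
  apply wp_assign
  rw [eb]
  generalize q / A.card = b at hb ⊢
  set s₂ := s₁.setReg rB b with hs₂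
  have hE₂ : Env A s₂ := hE₁.setReg (by decide)
  generalize hg : s.arr aMain = g at *
  have eu : (read aMain (indexExpr (reg rA) (reg rB) (reg rB))).eval s₂ =
      g (a + b * A.card + b * A.card * A.card) := by
    rw [eval, hE₂.eval_index (x := a) (y := b) (z := b) (by simp [hs₁, hs₂, eval])
      (by simp [hs₂, eval]) (by simp [hs₂, eval]) hb hb, ← hg]
    rfl
  apply wp_seq
  apply wp_assign
  rw [eu]
  have hu := hT.lt (index_lt ha hb hb)
  generalize hue : g (a + b * A.card + b * A.card * A.card) = u at hu ⊢
  set s₃ := s₂.setReg rTabb u with hs₃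
  have hE₃ : Env A s₃ := hE₂.setReg (by decide)
  apply wp_seq
  refine tabulate_spec (fun p => p % A.card) hE₃ (by decide)
    (fun p t hp hEt hpt _ _ => hEt.eval_fst hpt hp) fun s₄ hE₄ hr₄ ha₄ h₄ => ?_
  have hmain₄ : s₄.arr aMain = g := (ha₄ _ (by decide)).trans hg
  have hfail₄ : s₄.reg rFail = s.reg rFail := by
    rw [hr₄ _ (by decide)]; simp [hs₁, hs₂, hs₃]
  apply wp_seq
  refine wp_for (M := A.card * A.card) (fun k t => A.TermTable (t.arr aSide) ∧
      (t.reg rFail ≠ 0 → s.reg rFail ≠ 0 ∨ ¬ ∃ g, A.MaltsevTable g) ∧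
      (t.reg rFail = 0 → s.reg rFail = 0 ∧
        t.arr aSide (a + u * A.card + u * A.card * A.card) = a ∧
        ∀ j < k, t.arr aSide (j % A.card + j % A.card * A.card + j / A.card * A.card * A.card)
          = j / A.card)) (sq_le_arithLength.trans (Nat.le_succ _)) hE₄.sq rfl rfl ?_ ?_ ?_
  · refine ⟨termTable_fst.congr h₄, fun h => .inl ?_, fun h => ⟨?_, ?_, ?_⟩⟩
    · simpa [hfail₄] using h
    · simpa [hfail₄] using h
    · rw [State.setReg_arr, h₄ _ (index_lt ha hu hu), index_mod ha]
    · exact fun _ h => absurd h (Nat.not_lt_zero _)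
  · rintro k t hk hft hkt ⟨hTt, hf₁, hf₂⟩
    refine (innerProg_spec (a := a) (u := u) (q := k) hA hn (hE₄.frame hft rfl) ?_ ?_ hkt ha hu hk
      hTt).mono fun t' _ ⟨hTt', hf₃, hf₄⟩ => ⟨hTt', fun h => ?_, fun h => ?_⟩
    · rw [hft.reg _ rfl, hr₄ _ (by decide)]; simp [hs₁, hs₂, hs₃]
    · rw [hft.reg _ rfl, hr₄ _ (by decide)]; simp [hs₃]
    · rcases hf₃ (by simpa using h) with h | h
      exacts [hf₁ h, .inr h]
    · obtain ⟨h₅, h₆, h₇, h₈⟩ := hf₄ (by simpa using h)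
      obtain ⟨h₉, h₁₀, h₁₁⟩ := hf₂ h₅
      refine ⟨h₉, h₆ h₁₀, fun j hj => ?_⟩
      rcases Nat.lt_succ_iff_lt_or_eq.1 hj with hj' | rfl
      · exact h₈ _ (Nat.mod_lt _ hn0) _ (Nat.div_lt_of_lt_mul (hj'.trans hk)) (h₁₁ j hj')
      · exact h₇
  rintro s₅ hf₅ ⟨hTs, hf₁, hf₂⟩
  have hE₅ := hE₄.frame hf₅ rfl
  have hmain₅ : s₅.arr aMain = g := (hf₅.arr _ rfl).trans hmain₄
  have hg' := hTs.comp termTable_fst (hT.comp termTable_fst termTable_snd termTable_snd) hT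
  generalize hk : s₅.arr aSide = k at *
  apply wp_seq
  refine tabulate_spec (fun p => k (p % A.card +
      g (p % A.card + p / A.card % A.card * A.card + p / A.card % A.card * A.card * A.card) *
        A.card + g p * A.card * A.card)) hE₅ (by decide) ?_ ?_
  · intro p t hp hEt hpt _ hat
    have ht : t.arr aSide = k := (hat _ (by decide)).trans hk
    have ht' : t.arr aMain = g := (hat _ (by decide)).trans hmain₅
    have hx₀ : p % A.card < A.card := Nat.mod_lt _ hn0
    have hx₁ : p / A.card % A.card < A.card := Nat.mod_lt _ hn0
    have e₁ : (read aMain (indexExpr fstExpr sndExpr sndExpr)).eval t =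
        g (p % A.card + p / A.card % A.card * A.card +
          p / A.card % A.card * A.card * A.card) := by
      rw [eval, hEt.eval_index (hEt.eval_fst hpt hp) (hEt.eval_snd hpt hp) (hEt.eval_snd hpt hp)
        hx₁ hx₁, ht']
    have e₂ : (read aMain (reg rPos)).eval t = g p := by simp [eval, hpt, ht']
    rw [eval, hEt.eval_index (hEt.eval_fst hpt hp) e₁ e₂ (hT.lt (index_lt hx₀ hx₁ hx₁))
      (hT.lt hp), ht]
  intro s₆ hE₆ hr₆ ha₆ h₆
  refine tabulate_spec (s₆.arr aScratch) hE₆ (by decide) ?_ ?_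
  · intro p t _ _ hpt _ hat
    simp [eval, hpt, hat aScratch (by decide)]
  intro s₇ hE₇ hr₇ ha₇ h₇
  have hfail₇ : s₇.reg rFail = s₅.reg rFail := by rw [hr₇ _ (by decide), hr₆ _ (by decide)]
  have hval : ∀ x y z, x < A.card → y < A.card → z < A.card →
      s₇.arr aMain (x + y * A.card + z * A.card * A.card) =
      k (x + g (x + y * A.card + y * A.card * A.card) * A.card +
        g (x + y * A.card + z * A.card * A.card) * A.card * A.card) := by
    intro x y z hx hy hz
    rw [h₇ _ (index_lt hx hy hz), h₆ _ (index_lt hx hy hz), index_div_mod hx hy, index_mod hx]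
  refine ⟨hg'.congr fun p hp => by rw [h₇ p hp, h₆ p hp], fun h => hf₁ (hfail₇ ▸ h), fun h => ?_⟩
  obtain ⟨h₈, h₉, h₁₀⟩ := hf₂ (hfail₇ ▸ h)
  refine ⟨h₈, fun c hc d hd => ?_, ?_, fun a' ha' b' hb' h₁₁ => ?_⟩
  -- The loops code (c,d) as c + d n, least significant coordinate first, unlike the pool keys.
  · have := h₁₀ (c + d * A.card) (by rw [add_comm]; exact pair_lt hd hc)
    rw [Nat.add_mul_mod_self_right, Nat.mod_eq_of_lt hc, Nat.add_mul_div_right _ _ hn0,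
      Nat.div_eq_of_lt hc, zero_add] at this
    rw [hval c c d hc hc hd, hright h₈ c hc d hd, hT.idem hA hc, this]
  · rw [hval a b b ha hb hb, hue, h₉]
  · rw [hval a' b' b' ha' hb' hb', h₁₁, hTs.idem hA ha']

theorem maltsevProg_spec (hA : A.IsIdempotent) (hn : 2 ≤ A.card) (hE : Env A s)
    (hfail : s.reg rFail = 0) :
    wp (loopBound A) maltsevProg (fun s' =>
      (s'.reg rCard = 1 ∧ A.MaltsevTable (s'.arr aMain)) ∨
      (s'.reg rCard = 0 ∧ ¬ ∃ g, A.MaltsevTable g)) s := by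
  have hn0 : 0 < A.card := by omega
  apply wp_seq
  refine tabulate_spec (fun p => p / A.card / A.card) hE (by decide)
    (fun p t hp hEt hpt _ _ => hEt.eval_thd hpt hp) fun s₁ hE₁ hr₁ ha₁ h₁ => ?_
  have hfail₁ : s₁.reg rFail = 0 := (hr₁ _ (by decide)).trans hfail
  apply wp_seq
  refine wp_for (M := A.card * A.card) (fun k t => A.TermTable (t.arr aMain) ∧
      (t.reg rFail ≠ 0 → ¬ ∃ g, A.MaltsevTable g) ∧
      (t.reg rFail = 0 →
        (∀ c < A.card, ∀ d < A.card,
          t.arr aMain (c + c * A.card + d * A.card * A.card) = d) ∧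
        ∀ j < k, t.arr aMain (j % A.card + j / A.card * A.card + j / A.card * A.card * A.card)
          = j % A.card)) (sq_le_arithLength.trans (Nat.le_succ _)) hE₁.sq rfl rfl ?_ ?_ ?_
  · refine ⟨termTable_thd.congr h₁, fun h => absurd (by simpa using hfail₁) h,
      fun _ => ⟨fun c hc d hd => ?_, fun _ h => absurd h (Nat.not_lt_zero _)⟩⟩
    rw [State.setReg_arr, h₁ _ (index_lt hc hc hd), index_div_div hc hc]
  · rintro k t hk hft hkt ⟨hT, h₂, h₃⟩
    refine (outerProg_spec hA hn (hE₁.frame hft rfl) hkt hk hT fun h => (h₃ h).1).mono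
      fun t' _ ⟨hT', h₄, h₅⟩ => ⟨hT', fun h => ?_, fun h => ?_⟩
    · exact (h₄ (by simpa using h)).elim h₂ id
    · obtain ⟨h₆, h₇, h₈, h₉⟩ := h₅ (by simpa using h)
      refine ⟨h₇, fun j hj => ?_⟩
      rcases Nat.lt_succ_iff_lt_or_eq.1 hj with hj' | rfl
      · exact h₉ _ (Nat.mod_lt _ hn0) _ (Nat.div_lt_of_lt_mul (hj'.trans hk)) ((h₃ h₆).2 j hj')
      · exact h₈
  · rintro s₂ - ⟨hT, h₂, h₃⟩
    apply wp_assign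
    by_cases h : s₂.reg rFail = 0
    · obtain ⟨h₄, h₅⟩ := h₃ h
      refine .inl ⟨by simp [eval, h], hT, h₄, fun x hx y hy => ?_⟩
      have := h₅ (y + x * A.card) (by rw [add_comm]; exact pair_lt hx hy)
      rwa [Nat.add_mul_mod_self_right, Nat.mod_eq_of_lt hy, Nat.add_mul_div_right _ _ hn0,
        Nat.div_eq_of_lt hy, zero_add] at this
    · exact .inr ⟨by simp [eval]; omega, h₂ h⟩

theorem mainProg_spec (hA : A.IsIdempotent) :
    wp (loopBound A) mainProg (fun s' =>
      ((∃ m, A.IsMaltsevTermOperation m) →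
        ∃ m, A.IsMaltsevTermOperation m ∧ OutputsTable s' (opTable m)) ∧
      ((¬ ∃ m, A.IsMaltsevTermOperation m) → OutputsNone s')) (inputState A) := by
  apply wp_ite
  · intro h
    have hn : 2 ≤ A.card := by
      simp [eval, inputState] at h
      omega
    apply wp_seq
    refine (setupProg_spec hn).mono fun s₁ hf₁ hE₁ => ?_
    refine (maltsevProg_spec hA hn hE₁ (by rw [hf₁.reg _ rfl]; simp [inputState])).mono
      fun s₂ _ h₂ => ?_
    rcases h₂ with ⟨h₂, h₃⟩ | ⟨h₂, h₃⟩
    · obtain ⟨m, hm, ho⟩ := h₃.exists_operation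
      exact ⟨fun _ => ⟨m, hm, h₂, ho⟩, fun h => absurd ⟨m, hm⟩ h⟩
    · exact ⟨fun ⟨m, hm⟩ => absurd hm.exists_table h₃, fun _ => h₂⟩
  · intro h
    have hn : A.card ≤ 1 := by
      simp [eval, inputState] at h
      omega
    apply wp_assign
    have hm := isMaltsevTermOperation_of_card_le_one hn
    refine ⟨fun _ => ⟨_, hm, by simp [eval], ?_⟩, fun h => absurd ⟨_, hm⟩ h⟩
    refine List.ext_getElem (by simp) fun c _ _ => ?_
    simp only [opTable, List.getElem_map, List.getElem_ofFn]
    -- The output array is still all zero, and so is the table to be produced.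
    have : ∀ x : Fin A.card, (x : ℕ) = 0 := fun x => by omega
    rw [this]
    simp [inputState]

/-! ### Passing from the loop bound to a polynomial in the size. -/

/-- One non-nullary operation already contributes n^k ≥ n to the size. -/
theorem card_le_size (h₀ : 0 < A.numOps) (h₁ : ∀ i, 0 < A.arity i) : A.card ≤ A.size :=
  (Nat.le_self_pow (h₁ ⟨0, h₀⟩).ne' _).trans (pow_arity_le_size _)

theorem bound_eval_mono (p : Polynomial ℕ) {m n : ℕ} (h : m ≤ n) : p.eval m ≤ p.eval n := by
  simp only [Polynomial.eval_eq_sum, Polynomial.sum]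
  gcongr

end RAM

theorem corollary4p3 :
    ∃ (P : RAM.Prog) (p : Polynomial ℕ),
      ∀ A : FinAlgebra, 0 < A.numOps → (∀ i, 0 < A.arity i) → A.IsIdempotent →
        ∃ (t : ℕ) (s : RAM.State),
          RAM.Exec P (RAM.inputState A) t s ∧
          t ≤ p.eval A.size ∧
          ((∃ m, A.IsMaltsevTermOperation m) →
            ∃ m, A.IsMaltsevTermOperation m ∧ RAM.OutputsTable s (opTable m)) ∧
          ((¬ ∃ m, A.IsMaltsevTermOperation m) → RAM.OutputsNone s) := by
  -- The inner polynomial dominates the loop bound n⁴ + ‖A‖ + 1, because n ≤ ‖A‖.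
  refine ⟨RAM.mainProg, RAM.mainProg.bound.comp (Polynomial.X ^ 4 + Polynomial.X + 1),
    fun A h₀ h₁ hA => ?_⟩
  obtain ⟨t, s, hs, ht, h⟩ := RAM.mainProg_spec hA
  refine ⟨t, s, hs, ht.trans ?_, h⟩
  rw [Polynomial.eval_comp]
  apply RAM.bound_eval_mono
  simp only [Polynomial.eval_add, Polynomial.eval_pow, Polynomial.eval_X, Polynomial.eval_one,
    RAM.loopBound, RAM.arithLength]
  gcongr
  exact RAM.card_le_size h₀ h₁
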